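/- Let $G=(V,E)$ be a finite simple undirected graph with $n=|V|$ vertices, let $t\ge 0$ be an integer, and for $S\subseteq V$ let $G[S]$ denote the subgraph induced by $S$. The set $S$ is a \emph{2-club} if $G[S]$ has diameter at most two, that is, any two vertices of $S$ have distance at most two in $G[S]$. Moreover, $S$ is \begin{itemize} \item a \emph{$t$-robust 2-club} if any two distinct vertices of $S$ are connected in $G[S]$ by $t$ distinct, pairwise internally vertex-disjoint paths of length at most two; \item a \emph{$t$-hereditary 2-club} if $G[S\setminus U]$ is a 2-club for all $U\subseteq S$ with $|U|\le t$; \item a \emph{$t$-connected 2-club} if $S$ is a 2-club, $|S|>t$, and $G[S\setminus U]$ is connected for all $U\subseteq S$ with $|U|<t$. \end{itemize} The problems \textsc{$t$-Robust 2-Club}, \textsc{$t$-Hereditary 2-Club} and \textsc{$t$-Connected 2-Club} have as input a graph $G$ and nonnegative integers $t$ and $k$, and ask whether $G$ contains a $t$-robust, $t$-hereditary or $t$-connected 2-club, respectively, of size at least $k$. Each of the three problems can be solved in $O(1.62^n)$ time, where the bound is uniform in $t$ and $k$. Here time is the number of steps of a random access machine with unit-cost operations whose machine words hold $O(\log n)$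 bits in addition to the numbers $t$ and $k$, and $G$ is given by its adjacency matrix. -/

import Mathlib

/-! ## The three models of well-connected 2-clubs -/

namespace TwoClub

variable {V : Type*}

/-- `S` is a 2-club in `G`: the induced subgraph `G[S]` has diameter at most two (`ediam` is the
supremum of all distances, and the distance between disconnected vertices is `⊤`). -/
def IsTwoClub (G : SimpleGraph V) (S : Set V) : Prop :=
  (G.induce S).ediam ≤ 2

/-- Two `u`-`v` paths are internally vertex-disjoint: they share no vertex except `u` and `v`. -/
def InternallyDisjoint {G : SimpleGraph V} {u v : V} (p q : G.Path u v) : Prop :=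
  ∀ x, x ∈ p.1.support → x ∈ q.1.support → x = u ∨ x = v

/-- `S` is a `t`-robust 2-club in `G`: any two distinct vertices of `S` are connected in `G[S]` by
`t` (distinct) internally vertex-disjoint paths of length at most two. -/
def IsRobust (t : ℕ) (G : SimpleGraph V) (S : Finset V) : Prop :=
  ∀ u v : (S : Set V), u ≠ v →
    ∃ P : Finset ((G.induce (S : Set V)).Path u v),
      P.card = t ∧ (∀ p ∈ P, p.1.length ≤ 2) ∧
        (P : Set ((G.induce (S : Set V)).Path u v)).Pairwise InternallyDisjoint

/-- `S` is a `t`-hereditary 2-club in `G`: `G[S \ U]` is a 2-club for all `U ⊆ S` with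
`|U| ≤ t`. -/
def IsHereditary (t : ℕ) (G : SimpleGraph V) (S : Finset V) : Prop :=
  ∀ U : Finset V, U ⊆ S → U.card ≤ t → IsTwoClub G ((S : Set V) \ (U : Set V))

/-- `S` is a `t`-connected 2-club in `G`: it is a 2-club, `|S| > t`, and `G[S \ U]` is connected
for all `U ⊆ S` with `|U| < t`. -/
def IsConnected (t : ℕ) (G : SimpleGraph V) (S : Finset V) : Prop :=
  IsTwoClub G (S : Set V) ∧ t < S.card ∧
    ∀ U : Finset V, U ⊆ S → U.card < t →
      (G.induce ((S : Set V) \ (U : Set V))).Connected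

/-- A decision problem whose instances consist of a graph on `n` vertices and two nonnegative
integers `t` and `k`. -/
abbrev Problem : Type := (n : ℕ) → SimpleGraph (Fin n) → (t k : ℕ) → Prop

/-- Does `G` contain a `t`-robust 2-club of size at least `k`? -/
def RobustTwoClub : Problem := fun n G t k =>
  ∃ S : Finset (Fin n), IsRobust t G S ∧ k ≤ S.card

/-- Does `G` contain a `t`-hereditary 2-club of size at least `k`? -/
def HereditaryTwoClub : Problem := fun n G t k =>
  ∃ S : Finset (Fin n), IsHereditary t G S ∧ k ≤ S.card

/-- Does `G` contain a `t`-connected 2-club of size at least `k`? -/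
def ConnectedTwoClub : Problem := fun n G t k =>
  ∃ S : Finset (Fin n), IsConnected t G S ∧ k ≤ S.card

end TwoClub

/-! ## Random access machines with bounded word length

The memory consists of registers and arrays, all of whose cells hold natural numbers. Registers
and arrays are named by numerals that are fixed in the program, so that a program uses only
finitely many of them; array cells are addressed indirectly. Every operation takes unit time, and
every number that occurs in a computation, an array index included, has to fit into a machine
word, that is, must not exceed a bound `B`; a computation in which this fails does not count. -/

namespace WordRAM

/-- The contents of the memory: `reg i` is the value of register `i`, and `arr a j` is the value of
cell `j` of array `a`. -/
structure Store where
  reg : ℕ → ℕ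
  arr : ℕ → ℕ → ℕ

/-- The binary operations of the machine. -/
inductive Op where
  | add
  | sub
  | mul
  | lt
  | eq

/-- Subtraction is truncated at zero, and comparisons return `1` (true) or `0` (false). -/
def Op.apply : Op → ℕ → ℕ → ℕ
  | .add, x, y => x + y
  | .sub, x, y => x - y
  | .mul, x, y => x * y
  | .lt, x, y => if x < y then 1 else 0
  | .eq, x, y => if x = y then 1 else 0

/-- Expressions: constants, registers, array cells with a computed index, binary operations. -/
inductive Expr where
  | const (c : ℕ)
  | reg (i : ℕ)
  | cell (a : ℕ) (index : Expr)
  | op (o : Op) (e₁ e₂ : Expr)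

/-- The value of an expression. -/
def Expr.eval (s : Store) : Expr → ℕ
  | .const c => c
  | .reg i => s.reg i
  | .cell a e => s.arr a (e.eval s)
  | .op o e₁ e₂ => o.apply (e₁.eval s) (e₂.eval s)

/-- The time for the evaluation of an expression: one step for each of its nodes. -/
def Expr.cost : Expr → ℕ
  | .const _ => 1
  | .reg _ => 1
  | .cell _ e => e.cost + 1
  | .op _ e₁ e₂ => e₁.cost + e₂.cost + 1

/-- All numbers that occur in the evaluation of the expression are at most `B`. -/
def Expr.Fits (B : ℕ) (s : Store) : Expr → Prop
  | .const c => c ≤ B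
  | .reg i => s.reg i ≤ B
  | .cell a e => e.Fits B s ∧ s.arr a (e.eval s) ≤ B
  | .op o e₁ e₂ => e₁.Fits B s ∧ e₂.Fits B s ∧ o.apply (e₁.eval s) (e₂.eval s) ≤ B

/-- Programs. In tests, a nonzero value means true. -/
inductive Prog where
  | skip
  /-- put the value of `e` into register `i` -/
  | set (i : ℕ) (e : Expr)
  /-- put the value of `e` into the cell of array `a` with the given index -/
  | store (a : ℕ) (index e : Expr)
  | seq (p q : Prog)
  /-- run `p` if the value of `e` is nonzero, and `q` otherwise -/
  | cond (e : Expr) (p q : Prog)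
  /-- run `p` repeatedly, as long as the value of `e` is nonzero -/
  | loop (e : Expr) (p : Prog)

/-- `Exec B p s τ s'`: started with memory `s`, the program `p` halts after exactly `τ` steps with
memory `s'`, and no number exceeds `B` during the computation. -/
inductive Exec (B : ℕ) : Prog → Store → ℕ → Store → Prop
  | skip (s : Store) : Exec B .skip s 1 s
  | set (s : Store) (i : ℕ) (e : Expr) (he : e.Fits B s) :
      Exec B (.set i e) s (e.cost + 1) { s with reg := Function.update s.reg i (e.eval s) }
  | store (s : Store) (a : ℕ) (d e : Expr) (hd : d.Fits B s) (he : e.Fits B s) :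
      Exec B (.store a d e) s (d.cost + e.cost + 1)
        { s with
          arr := Function.update s.arr a (Function.update (s.arr a) (d.eval s) (e.eval s)) }
  | seq {p q : Prog} {s s' s'' : Store} {τ τ' : ℕ}
      (hp : Exec B p s τ s') (hq : Exec B q s' τ' s'') :
      Exec B (.seq p q) s (τ + τ') s''
  | cond_true {e : Expr} {p q : Prog} {s s' : Store} {τ : ℕ}
      (he : e.Fits B s) (hne : e.eval s ≠ 0) (hp : Exec B p s τ s') :
      Exec B (.cond e p q) s (e.cost + 1 + τ) s'
  | cond_false {e : Expr} {p q : Prog} {s s' : Store} {τ : ℕ}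
      (he : e.Fits B s) (heq : e.eval s = 0) (hq : Exec B q s τ s') :
      Exec B (.cond e p q) s (e.cost + 1 + τ) s'
  | loop_true {e : Expr} {p : Prog} {s s' s'' : Store} {τ τ' : ℕ}
      (he : e.Fits B s) (hne : e.eval s ≠ 0) (hp : Exec B p s τ s')
      (hl : Exec B (.loop e p) s' τ' s'') :
      Exec B (.loop e p) s (e.cost + 1 + τ + τ') s''
  | loop_false {e : Expr} {p : Prog} {s : Store}
      (he : e.Fits B s) (heq : e.eval s = 0) :
      Exec B (.loop e p) s (e.cost + 1) s

open Classical in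
/-- The memory at the start: registers `0`, `1`, `2` hold `n`, `t`, `k`, array `0` holds the
adjacency matrix of the graph row by row, and all other cells hold `0`. -/
noncomputable def input (n : ℕ) (G : SimpleGraph (Fin n)) (t k : ℕ) : Store where
  reg i := if i = 0 then n else if i = 1 then t else if i = 2 then k else 0
  arr a m :=
    if a = 0 ∧ ∃ i j : Fin n, m = (i : ℕ) * n + (j : ℕ) ∧ G.Adj i j then 1 else 0

open Classical in
/-- The program `p` decides the problem `Q`, and on every instance with `n` vertices it takes at
most `T n` steps, whatever the numbers `t` and `k` are. Its answer, `1` (yes) or `0` (no), is left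
in register `0`. The numbers `t` and `k` fit into a machine word, and apart from that the word
length is `O(log n)`: for some constant `c`, numbers up to `(n + 2) ^ c + t + k` are allowed. -/
def DecidesInTime (p : Prog) (Q : TwoClub.Problem) (T : ℕ → ℕ) : Prop :=
  ∃ c : ℕ, ∀ (n : ℕ) (G : SimpleGraph (Fin n)) (t k : ℕ),
    ∃ (τ : ℕ) (s : Store), Exec ((n + 2) ^ c + t + k) p (input n G t k) τ s ∧
      τ ≤ T n ∧ s.reg 0 = if Q n G t k then 1 else 0

/-- The problem `Q` can be solved in `O(g(n))` time, where `n` is the number of vertices. -/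
def SolvableInTimeO (Q : TwoClub.Problem) (g : ℕ → ℝ) : Prop :=
  ∃ (p : Prog) (T : ℕ → ℕ), DecidesInTime p Q T ∧
    (fun n => (T n : ℝ)) =O[Filter.atTop] g

end WordRAM

/-!
In all three cases a set is a solution if it is large enough and no two of its vertices form an
obstruction, where an obstruction of `u` and `v` in a set remains one in every subset that contains
`u` and `v`. Hence the vertices that are not deleted yet form a solution or contain an obstruction
of some `u` and `v`, and then every solution lacks one of the two. If one of them has already been
decided to be kept, the other one is deleted; otherwise either `u` is deleted, or `u` is kept and
`v` is deleted. The two branches have one and two undecided vertices fewer, so that the search tree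
has Fibonacci size, and the golden ratio is less than `1.62`.

Obstructions are found in polynomial time. For hereditary and robust 2-clubs it suffices to count
paths of length at most two. For connected 2-clubs one compares the minimum size of a vertex
separator with `t` by means of a maximum flow in the network with split vertices; the flow is
tracked only through the capacities of the cuts in the residual network, each of which drops by one
with every augmentation.
-/

namespace WordRAM

open Polynomial

section ProgramLogic

variable {B N : ℕ} {e f : Expr} {p q : Prog} {s s' s'' : Store} {P Q : Store → Prop}

/-- Every number in the memory is at most `B`. -/
structure Store.Bounded (s : Store) (B : ℕ) : Prop where
  one_le : 1 ≤ B
  reg : ∀ i, s.reg i ≤ B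
  arr : ∀ a j, s.arr a j ≤ B

/-- The memory after `v` is written to register `i`. -/
def Store.setReg (s : Store) (i v : ℕ) : Store :=
  { s with reg := Function.update s.reg i v }

/-- The memory after `v` is written to cell `j` of array `a`. -/
def Store.setCell (s : Store) (a j v : ℕ) : Store :=
  { s with arr := Function.update s.arr a (Function.update (s.arr a) j v) }

theorem Store.Bounded.setReg {i v : ℕ} (h : s.Bounded B) (hv : v ≤ B) :
    (s.setReg i v).Bounded B :=
  ⟨h.one_le, fun j => by by_cases hj : j = i <;> simp [Store.setReg, hj, hv, h.reg], h.arr⟩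

theorem Store.Bounded.setCell {a j v : ℕ} (h : s.Bounded B) (hv : v ≤ B) :
    (s.setCell a j v).Bounded B :=
  ⟨h.one_le, h.reg, fun b k => by
    by_cases hb : b = a <;> by_cases hk : k = j <;> simp [Store.setCell, hb, hk, hv, h.arr]⟩

/-! ### Expressions -/

/-- A number is read as the register of that name; numerals are constants, by the next instance. -/
instance : Coe ℕ Expr := ⟨.reg⟩

instance (c : ℕ) : OfNat Expr c := ⟨.const c⟩

instance : Add Expr := ⟨.op .add⟩

instance : Sub Expr := ⟨.op .sub⟩

instance : Mul Expr := ⟨.op .mul⟩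

infix:50 " <ₑ " => Expr.op Op.lt

infix:50 " =ₑ " => Expr.op Op.eq

/-- In a memory with bounded entries, `e` has the value `v`, and its evaluation does not
overflow. -/
def Expr.HasValue (B : ℕ) (s : Store) (e : Expr) (v : ℕ) : Prop :=
  (s.Bounded B → e.Fits B s) ∧ e.eval s = v

open Classical in
/-- `e` evaluates to the truth value of `P`. -/
def Expr.Decides (B : ℕ) (s : Store) (e : Expr) (P : Prop) : Prop :=
  e.HasValue B s (if P then 1 else 0)

namespace Expr

theorem fits_eval_le (h : e.Fits B s) : e.eval s ≤ B := by
  cases e with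
  | const | reg => exact h
  | cell => exact h.2
  | op => exact h.2.2

namespace HasValue

variable {x y i a : ℕ}

theorem eval_le (h : e.HasValue B s x) (hs : s.Bounded B) : x ≤ B :=
  h.2 ▸ fits_eval_le (h.1 hs)

theorem reg (h : s.reg i = x) : HasValue B s (i : Expr) x :=
  ⟨fun hs => hs.reg i, h⟩

theorem zero : HasValue B s 0 0 :=
  ⟨fun _ => Nat.zero_le _, rfl⟩

theorem one : HasValue B s 1 1 :=
  ⟨fun hs => hs.one_le, rfl⟩

theorem const (h : x ≤ B) : HasValue B s (Expr.const x) x :=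
  ⟨fun _ => h, rfl⟩

theorem cell (he : e.HasValue B s i) (h : s.arr a i = x) : HasValue B s (.cell a e) x :=
  ⟨fun hs => ⟨he.1 hs, hs.arr _ _⟩, by rw [eval, he.2, h]⟩

theorem add (he : e.HasValue B s x) (hf : f.HasValue B s y) (h : x + y ≤ B) :
    HasValue B s (e + f) (x + y) := by
  have hv : (e + f).eval s = x + y := congrArg₂ (· + ·) he.2 hf.2
  exact ⟨fun hs => ⟨he.1 hs, hf.1 hs, hv.trans_le h⟩, hv⟩

theorem sub (he : e.HasValue B s x) (hf : f.HasValue B s y) : HasValue B s (e - f) (x - y) := by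
  have hv : (e - f).eval s = x - y := congrArg₂ (· - ·) he.2 hf.2
  exact ⟨fun hs => ⟨he.1 hs, hf.1 hs, hv.trans_le ((Nat.sub_le _ _).trans (he.eval_le hs))⟩, hv⟩

theorem mul (he : e.HasValue B s x) (hf : f.HasValue B s y) (h : x * y ≤ B) :
    HasValue B s (e * f) (x * y) := by
  have hv : (e * f).eval s = x * y := congrArg₂ (· * ·) he.2 hf.2
  exact ⟨fun hs => ⟨he.1 hs, hf.1 hs, hv.trans_le h⟩, hv⟩

theorem lt (he : e.HasValue B s x) (hf : f.HasValue B s y) : (e <ₑ f).Decides B s (x < y) := by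
  have hv : (e <ₑ f).eval s = if x < y then 1 else 0 := congrArg₂ Op.lt.apply he.2 hf.2
  refine ⟨fun hs => ⟨he.1 hs, hf.1 hs, hv.trans_le ?_⟩, by convert hv⟩
  have := hs.one_le
  split_ifs <;> omega

theorem eq (he : e.HasValue B s x) (hf : f.HasValue B s y) : (e =ₑ f).Decides B s (x = y) := by
  have hv : (e =ₑ f).eval s = if x = y then 1 else 0 := congrArg₂ Op.eq.apply he.2 hf.2
  refine ⟨fun hs => ⟨he.1 hs, hf.1 hs, hv.trans_le ?_⟩, by convert hv⟩
  have := hs.one_le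
  split_ifs <;> omega

theorem decides {P : Prop} [Decidable P] (h : e.HasValue B s (if P then 1 else 0)) :
    e.Decides B s P := by
  unfold Decides
  convert h

end HasValue

theorem Decides.hasValue {P : Prop} [Decidable P] (h : e.Decides B s P) :
    e.HasValue B s (if P then 1 else 0) := by
  unfold Decides at h
  convert h

theorem Decides.and {P Q : Prop} (he : e.Decides B s P) (hf : f.Decides B s Q) :
    (e * f).Decides B s (P ∧ Q) := by
  have hv : (e * f).eval s = _ := congrArg₂ (· * ·) he.2 hf.2
  refine ⟨fun hs => ⟨he.1 hs, hf.1 hs, hv.trans_le ?_⟩, hv.trans ?_⟩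
  · have := hs.one_le
    split_ifs <;> simp [this]
  · by_cases P <;> by_cases Q <;> simp_all

theorem Decides.congr {P Q : Prop} (he : e.Decides B s P) (h : P ↔ Q) : e.Decides B s Q :=
  propext h ▸ he

theorem Decides.not {P : Prop} (he : e.Decides B s P) : (e =ₑ 0).Decides B s (¬ P) :=
  (HasValue.eq he .zero).congr (by simp)

end Expr

/-! ### Frames -/

namespace Prog

/-- Some instruction of the program writes to register `i`. -/
@[simp] def writesReg (i : ℕ) : Prog → Bool
  | skip => false
  | set j _ => j == i
  | store _ _ _ => false
  | seq p q => p.writesReg i || q.writesReg i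
  | cond _ p q => p.writesReg i || q.writesReg i
  | loop _ p => p.writesReg i

/-- Some instruction of the program writes to array `a`. -/
@[simp] def writesArr (a : ℕ) : Prog → Bool
  | skip => false
  | set _ _ => false
  | store b _ _ => b == a
  | seq p q => p.writesArr a || q.writesArr a
  | cond _ p q => p.writesArr a || q.writesArr a
  | loop _ p => p.writesArr a

end Prog

/-- The memories `s` and `s'` agree except where the program `p` may write. -/
structure Frame (p : Prog) (s s' : Store) : Prop where
  reg : ∀ i, p.writesReg i = false → s'.reg i = s.reg i
  arr : ∀ a, p.writesArr a = false → s'.arr a = s.arr a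

theorem Frame.refl : Frame p s s :=
  ⟨fun _ _ => rfl, fun _ _ => rfl⟩

theorem Frame.trans (h : Frame p s s') (h' : Frame p s' s'') : Frame p s s'' :=
  ⟨fun i hi => (h'.reg i hi).trans (h.reg i hi), fun a ha => (h'.arr a ha).trans (h.arr a ha)⟩

theorem Frame.mono (h : Frame p s s') (hr : ∀ i, q.writesReg i = false → p.writesReg i = false)
    (ha : ∀ a, q.writesArr a = false → p.writesArr a = false) : Frame q s s' :=
  ⟨fun i hi => h.reg i (hr i hi), fun a hi => h.arr a (ha a hi)⟩

theorem Frame.setReg {i v : ℕ} : Frame (.set i e) s (s.setReg i v) :=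
  ⟨fun _ hj => Function.update_of_ne (ne_of_beq_false hj).symm _ _, fun _ _ => rfl⟩

theorem Exec.frame {τ : ℕ} (h : Exec B p s τ s') : Frame p s s' := by
  induction h with
  | skip => exact .refl
  | set => exact .setReg
  | store =>
    exact ⟨fun _ _ => rfl, fun b hb => Function.update_of_ne (ne_of_beq_false hb).symm _ _⟩
  | seq _ _ ihp ihq =>
    exact (ihp.mono (by simp +contextual)
      (by simp +contextual)).trans
        (ihq.mono (by simp +contextual) (by simp +contextual))
  | cond_true _ _ _ ih =>
    exact ih.mono (by simp +contextual) (by simp +contextual)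
  | cond_false _ _ _ ih =>
    exact ih.mono (by simp +contextual) (by simp +contextual)
  | loop_true _ _ _ _ ihp ihl =>
    exact (ihp.mono (by simp) (by simp)).trans ihl
  | loop_false => exact .refl

/-! ### Total correctness with a time bound -/

infixr:40 " ;; " => Prog.seq

/-- The running time of a program all of whose loops are run through at most `N` times, as a
polynomial in `N`. -/
noncomputable def Prog.time : Prog → ℕ[X]
  | .skip => 1
  | .set _ e => C (e.cost + 1)
  | .store _ d e => C (d.cost + e.cost + 1)
  | .seq p q => p.time + q.time
  | .cond e p q => C (e.cost + 1) + p.time + q.time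
  | .loop e p => (X + 1) * (C (e.cost + 1) + p.time)

/-- Started in a bounded memory `s`, the program `p` halts within the time that corresponds to `N`
iterations of its loops, the memory remains bounded, and `Q` holds at the end. -/
def WP (B N : ℕ) (p : Prog) (Q : Store → Prop) (s : Store) : Prop :=
  s.Bounded B → ∃ τ s', Exec B p s τ s' ∧ τ ≤ p.time.eval N ∧ s'.Bounded B ∧ Q s'

namespace WP

theorem mono (h : WP B N p P s) (hPQ : ∀ s', Frame p s s' → P s' → Q s') : WP B N p Q s := by
  intro hs
  obtain ⟨τ, s', hexec, hτ, hs', hP⟩ := h hs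
  exact ⟨τ, s', hexec, hτ, hs', hPQ s' hexec.frame hP⟩

theorem skip (h : Q s) : WP B N .skip Q s :=
  fun hs => ⟨1, s, .skip s, by simp [Prog.time], hs, h⟩

theorem set {i v : ℕ} (he : e.HasValue B s v) (h : Q (s.setReg i v)) : WP B N (.set i e) Q s := by
  intro hs
  refine ⟨_, _, .set s i e (he.1 hs), by simp [Prog.time], ?_, he.2 ▸ h⟩
  rw [he.2]
  exact hs.setReg (he.eval_le hs)

theorem store {a j v : ℕ} (hd : e.HasValue B s j) (he : f.HasValue B s v)
    (h : Q (s.setCell a j v)) : WP B N (.store a e f) Q s := by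
  intro hs
  refine ⟨_, _, .store s a e f (hd.1 hs) (he.1 hs), by simp [Prog.time], ?_, hd.2 ▸ he.2 ▸ h⟩
  rw [hd.2, he.2]
  exact hs.setCell (he.eval_le hs)

theorem bind (hp : WP B N p P s) (hq : ∀ s', Frame p s s' → P s' → WP B N q Q s') :
    WP B N (p ;; q) Q s := by
  intro hs
  obtain ⟨τ, s', hp', hτ, hs', hP⟩ := hp hs
  obtain ⟨τ', s'', hq', hτ', hs'', hQ⟩ := hq s' hp'.frame hP hs'
  exact ⟨τ + τ', s'', .seq hp' hq', by simpa [Prog.time] using add_le_add hτ hτ', hs'', hQ⟩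

theorem cond {c : Prop} (he : e.Decides B s c) (hp : c → WP B N p Q s) (hq : ¬ c → WP B N q Q s) :
    WP B N (.cond e p q) Q s := by
  intro hs
  by_cases hc : c
  · obtain ⟨τ, s', hexec, hτ, h⟩ := hp hc hs
    refine ⟨_, s', .cond_true (he.1 hs) (by simp [he.2, hc]) hexec, ?_, h⟩
    simp only [Prog.time, eval_add, eval_C]
    omega
  · obtain ⟨τ, s', hexec, hτ, h⟩ := hq hc hs
    refine ⟨_, s', .cond_false (he.1 hs) (by simp [he.2, hc]) hexec, ?_, h⟩
    simp only [Prog.time, eval_add, eval_C]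
    omega

end WP

/-! ### Loops -/

/-- The number `m` bounds the number of iterations that remain. -/
theorem Exec.exists_loop {T : ℕ} {J : ℕ → Store → Prop} (fits : ∀ m s, J m s → e.Fits B s)
    (step : ∀ m s, J m s → e.eval s ≠ 0 →
      ∃ τ s' m', Exec B p s τ s' ∧ τ ≤ T ∧ m' < m ∧ J m' s') :
    ∀ m s, J m s → ∃ τ s' m', Exec B (.loop e p) s τ s' ∧ τ ≤ (m + 1) * (e.cost + 1 + T) ∧
      J m' s' ∧ e.eval s' = 0 := by
  intro m
  induction m using Nat.strong_induction_on with
  | _ m ih =>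
    intro s hs
    by_cases he : e.eval s = 0
    · exact ⟨_, s, m, .loop_false (fits m s hs) he, by nlinarith, hs, he⟩
    · obtain ⟨τ, s', m', hbody, hτ, hm, hs'⟩ := step m s hs he
      obtain ⟨τ', s'', m'', hloop, hτ', hs'', he'⟩ := ih m' hm s' hs'
      refine ⟨_, s'', m'', .loop_true (fits m s hs) he hbody hloop, ?_, hs'', he'⟩
      have := Nat.mul_le_mul_right (e.cost + 1 + T) (show m' + 2 ≤ m + 1 by omega)
      linarith

/-- The number `m` in `J m` is the number of iterations that remain. -/
theorem WP.loop {n : ℕ} (J : ℕ → Store → Prop) (hn : n ≤ N) (init : J n s)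
    (test : ∀ m s', Frame (.loop e p) s s' → J m s' → e.Decides B s' (m ≠ 0))
    (step : ∀ m s', Frame (.loop e p) s s' → J (m + 1) s' → WP B N p (J m) s') :
    WP B N (.loop e p) (J 0) s := by
  intro hs
  have hstep : ∀ m s', (Frame (.loop e p) s s' ∧ s'.Bounded B ∧ J m s') → e.eval s' ≠ 0 →
      ∃ τ s'' m', Exec B p s' τ s'' ∧ τ ≤ p.time.eval N ∧ m' < m ∧
        (Frame (.loop e p) s s'' ∧ s''.Bounded B ∧ J m' s'') := by
    rintro m s' ⟨hf, hs', hJ⟩ heval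
    obtain ⟨m, rfl⟩ := Nat.exists_eq_succ_of_ne_zero
      (show m ≠ 0 by simpa [(test m s' hf hJ).2] using heval)
    obtain ⟨τ, s'', hexec, hτ, hs'', hJ'⟩ := step m s' hf hJ hs'
    exact ⟨τ, s'', m, hexec, hτ, m.lt_succ_self,
      hf.trans (hexec.frame.mono (by simp) (by simp)), hs'', hJ'⟩
  obtain ⟨τ, s', m, hexec, hτ, ⟨hf, hs', hJ⟩, heval⟩ :=
    Exec.exists_loop (fun m s' h => (test m s' h.1 h.2.2).1 h.2.1) hstep n s ⟨.refl, hs, init⟩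
  obtain rfl : m = 0 := by simpa [(test m s' hf hJ).2] using heval
  refine ⟨τ, s', hexec, hτ.trans ?_, hs', hJ⟩
  simp only [Prog.time, eval_mul, eval_add, eval_X, eval_one, eval_C]
  gcongr

/-- Run `p` for `i = 0, …, b - 1`, where `i` and `b` are registers. -/
def Prog.forLoop (i b : ℕ) (p : Prog) : Prog :=
  .set i 0 ;; .loop (i <ₑ b) (p ;; .set i (i + 1))

@[simp]
theorem Prog.writesReg_forLoop {i b k : ℕ} :
    (Prog.forLoop i b p).writesReg k = (i == k || p.writesReg k) := by
  cases h : i == k <;> simp [Prog.forLoop, h]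

@[simp]
theorem Prog.writesArr_forLoop {i b a : ℕ} :
    (Prog.forLoop i b p).writesArr a = p.writesArr a := by
  simp [Prog.forLoop]

theorem WP.forLoop {i b n : ℕ} (I : ℕ → Store → Prop) (hb : s.reg b = n) (hn : n ≤ N)
    (init : I 0 s)
    (step : ∀ (j : Fin n) s', Frame (.forLoop i b p) s s' → s'.reg i = j → I j s' →
      WP B N p (I (j + 1)) s')
    (stable : ∀ j v s', I j s' → I j (s'.setReg i v) := by exact fun _ _ _ h => h)
    (hpi : p.writesReg i = false := by rfl) (hpb : p.writesReg b = false := by rfl)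
    (hib : i ≠ b := by decide) :
    WP B N (.forLoop i b p) (I n) s := by
  have hbound {s'} (hs' : Frame (Prog.forLoop i b p) s s') : s'.reg b = n :=
    (hs'.reg b (by simp [hpb, hib])).trans hb
  let J (m : ℕ) (s' : Store) : Prop := ∃ j, j + m = n ∧ s'.reg i = j ∧ I j s'
  refine bind (P := J n) (set .zero ⟨0, zero_add n, by simp [Store.setReg], stable _ _ _ init⟩)
    fun s₀ hf₀ hJ₀ => ?_
  have hframe {s'} (hs' : Frame (.loop (i <ₑ b) (p ;; .set i (i + 1))) s₀ s') :
      Frame (Prog.forLoop i b p) s s' :=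
    (hf₀.mono (by simp +contextual) (by simp)).trans (hs'.mono (by simp +contextual) (by simp))
  refine (WP.loop J hn hJ₀ ?_ ?_).mono ?_
  · rintro m s' hs' ⟨j, hjm, hj, -⟩
    exact (Expr.HasValue.reg hj).lt (.reg (hbound (hframe hs'))) |>.congr (by omega)
  · rintro m s' hs' ⟨j, hjm, hj, hI⟩
    refine bind (step ⟨j, by omega⟩ s' (hframe hs') hj hI) fun s'' hf hI' => ?_
    have hj' : s''.reg i = j := (hf.reg i hpi).trans hj
    intro hs''
    have hjB : j + 1 ≤ B :=
      (show j + 1 ≤ n by omega).trans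
        (hbound ((hframe hs').trans (hf.mono (by simp +contextual)
          (by simp))) ▸ hs''.reg b)
    exact set ((Expr.HasValue.reg hj').add .one hjB)
      ⟨j + 1, by omega, by simp [Store.setReg], stable _ _ _ hI'⟩ hs''
  · rintro s' - ⟨j, rfl, -, hI⟩
    exact hI

end ProgramLogic

end WordRAM

namespace WordRAM

open Finset

section LoopRules

variable {B N n : ℕ} {e f : Expr} {p : Prog} {s s' : Store} {Q : Store → Prop}

namespace WP

theorem assign {i v : ℕ} (he : e.HasValue B s v) : WP B N (.set i e) (fun s' => s'.reg i = v) s :=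
  set he (Function.update_self ..)

theorem write {a j v : ℕ} (hd : e.HasValue B s j) (he : f.HasValue B s v) :
    WP B N (.store a e f) (fun s' => s'.arr a = Function.update (s.arr a) j v) s :=
  store hd he (Function.update_self ..)

/-- In the invariant `I D`, the set `D` consists of the indices that have been dealt with. -/
theorem forEach {i b : ℕ} (I : Finset (Fin n) → Store → Prop) (hb : s.reg b = n) (hn : n ≤ N)
    (init : I ∅ s)
    (step : ∀ (D : Finset (Fin n)) (j : Fin n) s', Frame (.forLoop i b p) s s' → s'.reg i = j →
      j ∉ D → I D s' → WP B N p (I (insert j D)) s')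
    (stable : ∀ D v s', I D s' → I D (s'.setReg i v) := by exact fun _ _ _ h => h)
    (hpi : p.writesReg i = false := by rfl) (hpb : p.writesReg b = false := by rfl)
    (hib : i ≠ b := by decide) :
    WP B N (Prog.forLoop i b p) (I univ) s := by
  refine (forLoop (fun j s' => I (univ.filter fun k : Fin n => (k : ℕ) < j) s') hb hn
    (by simpa using init) (fun j s' hf hj hI => ?_) (fun _ => stable _) hpi hpb hib).mono
    fun s' _ h => by simpa using h
  have hinsert : univ.filter (fun k : Fin n => (k : ℕ) < j + 1) =
      insert j (univ.filter fun k : Fin n => (k : ℕ) < j) := by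
    ext k
    simp only [mem_filter, mem_univ, true_and, mem_insert, Fin.ext_iff]
    omega
  simpa only [hinsert] using step _ j s' hf hj (by simp) hI

end WP

/-- Run `p` for all pairs of values of the registers `i` and `j` that are less than register `b`. -/
def Prog.forPairs (i j b : ℕ) (p : Prog) : Prog :=
  .forLoop i b (.forLoop j b p)

@[simp]
theorem Prog.writesReg_forPairs {i j b k : ℕ} :
    (Prog.forPairs i j b p).writesReg k = (i == k || j == k || p.writesReg k) := by
  simp [Prog.forPairs, Bool.or_assoc]

@[simp]
theorem Prog.writesArr_forPairs {i j b a : ℕ} :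
    (Prog.forPairs i j b p).writesArr a = p.writesArr a := by
  simp [Prog.forPairs]

theorem WP.forPairs {i j b : ℕ} (I : Finset (Fin n × Fin n) → Store → Prop) (hb : s.reg b = n)
    (hn : n ≤ N) (init : I ∅ s)
    (step : ∀ D (x : Fin n × Fin n) s', Frame (.forPairs i j b p) s s' → s'.reg i = x.1 →
      s'.reg j = x.2 → I D s' → WP B N p (I (insert x D)) s')
    (stable : ∀ D v s', I D s' → I D (s'.setReg i v) ∧ I D (s'.setReg j v) := by
      exact fun _ _ _ h => ⟨h, h⟩)
    (hpi : p.writesReg i = false := by rfl) (hpj : p.writesReg j = false := by rfl)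
    (hpb : p.writesReg b = false := by rfl)
    (hib : i ≠ b := by decide) (hjb : j ≠ b := by decide) (hij : i ≠ j := by decide) :
    WP B N (Prog.forPairs i j b p) (I univ) s := by
  refine (forEach (fun D => I (D ×ˢ univ)) hb hn (by simpa using init)
    (fun D x s' hf hx _ hI => ?_) (fun D v s' h => (stable _ v s' h).1) (by simp [hpi, hij.symm])
    (by simp [hpb, hjb]) hib).mono fun s' _ h => by simpa using h
  have hrow (D' : Finset (Fin n)) (y : Fin n) :
      insert (x, y) (D ×ˢ univ ∪ {x} ×ˢ D') = D ×ˢ univ ∪ {x} ×ˢ insert y D' := by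
    ext ⟨u, v⟩
    simp only [mem_insert, mem_union, mem_product, mem_univ, mem_singleton, Prod.mk.injEq]
    tauto
  have hbs' : s'.reg b = n := (hf.reg b (by simp [hpb, hib, hjb])).trans hb
  refine (forEach (fun D' => I (D ×ˢ univ ∪ {x} ×ˢ D')) hbs' hn (by simpa using hI)
    (fun D' y s'' hf' hy _ hI' => ?_) (fun D v s' h => (stable _ v s' h).2) hpj hpb hjb).mono
    fun s'' _ h => ?_
  · rw [← hrow]
    exact step _ (x, y) s'' (hf.trans (hf'.mono (by simp +contextual) (by simp)))
      ((hf'.reg i (by simp [hpi, hij.symm])).trans hx) hy hI'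
  · rwa [insert_eq, union_product, union_comm]

/-- Put the number of values of register `i` less than register `b` for which `e` holds into
register `c`. -/
def Prog.countLoop (i b c : ℕ) (e : Expr) : Prog :=
  .set c 0 ;; .forLoop i b (.set c (c + e))

@[simp]
theorem Prog.writesReg_countLoop {i b c k : ℕ} :
    (Prog.countLoop i b c e).writesReg k = (c == k || i == k) := by
  cases h : c == k <;> simp [Prog.countLoop, h]

@[simp]
theorem Prog.writesArr_countLoop {i b c a : ℕ} : (Prog.countLoop i b c e).writesArr a = false := by
  simp [Prog.countLoop]

theorem WP.countLoop {i b c : ℕ} {P : Fin n → Prop} [DecidablePred P] (hb : s.reg b = n)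
    (hn : n ≤ N)
    (he : ∀ (j : Fin n) s', Frame (.countLoop i b c e) s s' → s'.reg i = j → e.Decides B s' (P j))
    (hci : c ≠ i := by decide) (hcb : c ≠ b := by decide) (hib : i ≠ b := by decide) :
    WP B N (.countLoop i b c e) (fun s' => s'.reg c = #{j | P j}) s := by
  refine bind (assign .zero) fun s₀ hf₀ h₀ => ?_
  have hb₀ : s₀.reg b = n := (hf₀.reg b (by simp [hcb])).trans hb
  refine forEach (fun D s' => s'.reg c = #{j ∈ D | P j}) hb₀ hn h₀ (fun D j s' hf hj hjD hD => ?_)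
    (fun D v s' h => (Function.update_of_ne hci _ _).trans h) (by simp [hci]) (by simp [hcb]) hib
  have hcard : #{k ∈ insert j D | P k} = #{k ∈ D | P k} + if P j then 1 else 0 := by
    rw [filter_insert]
    split_ifs <;> simp [hjD]
  have hdec : e.Decides B s' (P j) := he j s'
    ((hf₀.mono (by simp +contextual) (by simp)).trans (hf.mono (by simp +contextual) (by simp))) hj
  have hbs' : s'.reg b = n := (hf.reg b (by simp [hcb, hib])).trans hb₀
  intro hs'
  have hle : #{k ∈ insert j D | P k} ≤ B :=
    (card_le_univ _).trans (by simpa [hbs'] using hs'.reg b)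
  rw [hcard] at hle ⊢
  exact assign ((Expr.HasValue.reg hD).add hdec.hasValue hle) hs'

end LoopRules

/-! ### Rows, matrices and sets in memory -/

section Layout

variable {B n : ℕ} {s : Store}

/-- The row with number `r` of array `a`, whose rows have length `n`, is `f`. -/
def HoldsRow (a r : ℕ) (f : Fin n → ℕ) (s : Store) : Prop :=
  ∀ j : Fin n, s.arr a (r * n + j) = f j

/-- Array `a` contains the matrix `M`, row by row. -/
def HoldsMatrix (a : ℕ) (M : Fin n → Fin n → ℕ) (s : Store) : Prop :=
  ∀ i : Fin n, HoldsRow a i (M i) s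

/-- Array `a` is the characteristic vector of `S`. -/
def HoldsSet (a : ℕ) (S : Finset (Fin n)) (s : Store) : Prop :=
  ∀ v : Fin n, s.arr a v = if v ∈ S then 1 else 0

theorem Expr.HasValue.index {e f : Expr} {w x y : ℕ} (he : e.HasValue B s x) (hw : s.reg w = n)
    (hf : f.HasValue B s y) (h : x * n + y ≤ B) : HasValue B s (e * w + f) (x * n + y) :=
  (he.mul (.reg hw) (by omega)).add hf h

theorem index_inj {r r' : ℕ} {j j' : Fin n} (h : r * n + j = r' * n + j') : r = r' ∧ j = j' := by
  have hdiv := congrArg (· / n) h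
  have hmod := congrArg (· % n) h
  have hpos : 0 < n := j.pos
  simp only [Nat.add_comm (_ * n), Nat.add_mul_div_right _ _ hpos, Nat.div_eq_of_lt j.isLt,
    Nat.div_eq_of_lt j'.isLt, Nat.add_mul_mod_self_right, Nat.mod_eq_of_lt j.isLt,
    Nat.mod_eq_of_lt j'.isLt, zero_add] at hdiv hmod
  exact ⟨hdiv, Fin.ext hmod⟩

theorem HoldsRow.update {a r v : ℕ} {j : Fin n} {f : Fin n → ℕ} {s' : Store} (h : HoldsRow a r f s)
    (hs' : s'.arr a = Function.update (s.arr a) (r * n + j) v) :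
    HoldsRow a r (Function.update f j v) s' := by
  intro k
  rw [hs']
  rcases eq_or_ne k j with rfl | hk
  · simp
  · rw [Function.update_of_ne hk, Function.update_of_ne (fun hkj => hk (index_inj hkj).2), h k]

theorem HoldsRow.update_other {a r r' v : ℕ} {j : Fin n} {f : Fin n → ℕ} {s' : Store}
    (h : HoldsRow a r f s) (hr : r ≠ r')
    (hs' : s'.arr a = Function.update (s.arr a) (r' * n + j) v) : HoldsRow a r f s' := fun k => by
  rw [hs', Function.update_of_ne fun hkj => hr (index_inj hkj).1, h k]

theorem HoldsMatrix.update {a v : ℕ} {i j : Fin n} {M : Fin n → Fin n → ℕ} {s' : Store}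
    (h : HoldsMatrix a M s) (hs' : s'.arr a = Function.update (s.arr a) (i * n + j) v) :
    HoldsMatrix a (Function.update M i (Function.update (M i) j v)) s' := by
  intro k
  rcases eq_or_ne k i with rfl | hk
  · simpa using (h k).update hs'
  · simpa [hk] using (h k).update_other (Fin.val_ne_of_ne hk) hs'

end Layout

/-- The loop reads only what lies below the row that it writes. -/
theorem WP.fillRow {B N n i b a r : ℕ} {d e : Expr} {f : Fin n → ℕ} {s : Store}
    (hb : s.reg b = n) (hn : n ≤ N)
    (hd : ∀ (j : Fin n) s', Frame (.forLoop i b (.store a d e)) s s' → s'.reg i = j →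
      d.HasValue B s' (r * n + j))
    (he : ∀ (j : Fin n) s', Frame (.forLoop i b (.store a d e)) s s' →
      (∀ k < r * n, s'.arr a k = s.arr a k) → s'.reg i = j → e.HasValue B s' (f j))
    (hib : i ≠ b := by decide) :
    WP B N (.forLoop i b (.store a d e))
      (fun s' => HoldsRow a r f s' ∧ ∀ k < r * n, s'.arr a k = s.arr a k) s := by
  refine (forEach (fun D s' => (∀ j ∈ D, s'.arr a (r * n + j) = f j) ∧
    ∀ k < r * n, s'.arr a k = s.arr a k) hb hn (by simp) ?_ (hib := hib)).mono
      fun s' _ h => ⟨fun j => h.1 j (mem_univ j), h.2⟩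
  intro D j s' hf hj _ ⟨hD, hlow⟩
  refine (write (hd j s' hf hj) (he j s' hf hlow hj)).mono fun s'' _ hs'' => ⟨fun k hk => ?_, ?_⟩
  · rw [hs'']
    rcases eq_or_ne k j with rfl | hkj
    · simp
    · rw [Function.update_of_ne (by simpa [Fin.ext_iff] using hkj),
        hD k (mem_of_mem_insert_of_ne hk hkj)]
  · intro k hk
    rw [hs'', Function.update_of_ne (by omega), hlow k hk]

end WordRAM

namespace TwoClub

open Finset

section Branching

variable {V : Type*} {Φ : Finset V → Prop} {f : V → ℕ} {u v : V} {S : Finset V}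

/-- A node `f` of the search tree labels the deleted vertices with `0`, the undecided ones with `1`
and the ones that have to be kept with larger numbers. The set `S` extends `f` if it respects these
decisions. -/
def Extends (S : Finset V) (f : V → ℕ) : Prop :=
  ∀ v, (1 < f v → v ∈ S) ∧ (f v = 0 → v ∉ S)

/-- The node `f` of the search tree leads to a set with the property `Φ`. -/
def HasSolution (Φ : Finset V → Prop) (f : V → ℕ) : Prop :=
  ∃ S, Φ S ∧ Extends S f

/-- No set with the property `Φ` to which the node `f` leads contains both `u` and `v`. -/
def Excludes (Φ : Finset V → Prop) (f : V → ℕ) (u v : V) : Prop :=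
  ∀ S, Φ S → Extends S f → ¬ (u ∈ S ∧ v ∈ S)

theorem Excludes.symm (h : Excludes Φ f u v) : Excludes Φ f v u :=
  fun S hS hf huv => h S hS hf huv.symm

theorem Excludes.not_hasSolution (h : Excludes Φ f u v) (hu : 1 < f u) (hv : 1 < f v) :
    ¬ HasSolution Φ f :=
  fun ⟨S, hS, hf⟩ => h S hS hf ⟨(hf u).1 hu, (hf v).1 hv⟩

section Update

variable [DecidableEq V]

theorem extends_update_iff {c : ℕ} (hv : f v = 1) : Extends S (Function.update f v c) ↔
    Extends S f ∧ (1 < c → v ∈ S) ∧ (c = 0 → v ∉ S) := by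
  rw [Extends, Function.forall_update_iff f fun w c => (1 < c → w ∈ S) ∧ (c = 0 → w ∉ S), and_comm]
  refine and_congr_left fun _ => ⟨fun h w => ?_, fun h w _ => h w⟩
  rcases eq_or_ne w v with rfl | hw
  · simp [hv]
  · exact h w hw

theorem hasSolution_iff_or (hv : f v = 1) : HasSolution Φ f ↔
    HasSolution Φ (Function.update f v 0) ∨ HasSolution Φ (Function.update f v 2) := by
  simp only [HasSolution, ← exists_or, ← and_or_left, extends_update_iff hv]
  refine exists_congr fun S => and_congr_right fun _ => ?_
  by_cases hS : v ∈ S <;> simp [hS]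

theorem Excludes.hasSolution_iff_delete (h : Excludes Φ f u v) (hu : 1 < f u) (hv : f v = 1) :
    HasSolution Φ f ↔ HasSolution Φ (Function.update f v 0) := by
  refine exists_congr fun S => and_congr_right fun hS => ?_
  simpa [extends_update_iff hv] using fun hf hvS => h S hS hf ⟨(hf u).1 hu, hvS⟩

theorem Excludes.hasSolution_iff_branch (h : Excludes Φ f u v) (huv : u ≠ v) (hu : f u = 1)
    (hv : f v = 1) : HasSolution Φ f ↔ HasSolution Φ (Function.update f u 0) ∨
      HasSolution Φ (Function.update (Function.update f u 2) v 0) := by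
  have h' : Excludes Φ (Function.update f u 2) u v :=
    fun S hS hf => h S hS ((extends_update_iff hu).1 hf).1
  rw [hasSolution_iff_or hu, h'.hasSolution_iff_delete (by simp)
    (by rwa [Function.update_of_ne huv.symm])]

end Update

variable [Fintype V]

/-- The vertices that have not been deleted at the node `f` of the search tree. -/
def alive (f : V → ℕ) : Finset V := {v | f v ≠ 0}

/-- The vertices that are neither deleted nor kept at the node `f` of the search tree. -/
def undecided (f : V → ℕ) : Finset V := {v | f v = 1}

theorem extends_alive : Extends (alive f) f :=
  fun _ => ⟨fun h => by simpa [alive] using by omega, fun h => by simp [alive, h]⟩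

theorem Extends.subset_alive (h : Extends S f) : S ⊆ alive f :=
  fun v hv => by simpa [alive] using fun h0 => (h v).2 h0 hv

theorem card_undecided_update [DecidableEq V] {c : ℕ} (hv : f v = 1) (hc : c ≠ 1) :
    #(undecided (Function.update f v c)) + 1 = #(undecided f) := by
  have herase : undecided (Function.update f v c) = (undecided f).erase v := by
    ext w
    rcases eq_or_ne w v with rfl | hw <;> simp [undecided, *]
  rw [herase, card_erase_add_one (by simpa [undecided] using hv)]

/-- A bound for the size of the search tree below the node `f`: branching on an undecided pair of
vertices settles one vertex on one side and two on the other. -/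
def weight (f : V → ℕ) : ℕ := Nat.fib (#(undecided f) + 3) - 1

theorem weight_pos : 0 < weight f := by
  have := Nat.fib_mono (show 3 ≤ #(undecided f) + 3 by omega)
  simp only [weight]
  norm_num [Nat.fib] at this ⊢
  omega

theorem weight_update_lt [DecidableEq V] {c : ℕ} (hv : f v = 1) (hc : c ≠ 1) :
    weight (Function.update f v c) < weight f := by
  rw [weight, weight, ← card_undecided_update hv hc]
  generalize #(undecided (Function.update f v c)) = m
  have hlt : Nat.fib (m + 3) < Nat.fib (m + 1 + 3) := Nat.fib_lt_fib_succ (by omega)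
  have hpos : 0 < Nat.fib (m + 3) := Nat.fib_pos.2 (by omega)
  omega

theorem weight_branch_lt [DecidableEq V] (huv : u ≠ v) (hu : f u = 1) (hv : f v = 1) :
    weight (Function.update f u 0) + weight (Function.update (Function.update f u 2) v 0) <
      weight f := by
  have hu0 := card_undecided_update hu zero_ne_one
  have hu2 := card_undecided_update (c := 2) hu (by decide)
  have hv0 := card_undecided_update (f := Function.update f u 2) (v := v)
    (by rwa [Function.update_of_ne huv.symm]) zero_ne_one
  rw [weight, weight, weight, ← hu0, show #(undecided (Function.update f u 0)) =
    #(undecided (Function.update (Function.update f u 2) v 0)) + 1 by omega]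
  generalize #(undecided (Function.update (Function.update f u 2) v 0)) = m
  have hfib : Nat.fib (m + 1 + 1 + 3) = Nat.fib (m + 3) + Nat.fib (m + 1 + 3) := Nat.fib_add_two
  have hpos : 0 < Nat.fib (m + 3) := Nat.fib_pos.2 (by omega)
  have hpos' : 0 < Nat.fib (m + 1 + 3) := Nat.fib_pos.2 (by omega)
  omega

end Branching

section Admissible

variable {V : Type*} [Fintype V] {bad : Finset V → V → V → Prop} {acc : ℕ → Prop} {f : V → ℕ}
  {u v : V}

/-- The sets that the search algorithm looks for: no two distinct elements `u` and `v` of `S`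
satisfy `bad S u v`, and the size of `S` satisfies `acc`. -/
def IsAdmissible (bad : Finset V → V → V → Prop) (acc : ℕ → Prop) (S : Finset V) : Prop :=
  (S : Set V).Pairwise (fun u v => ¬ bad S u v) ∧ acc #S

theorem hasSolution_iff_acc (hacc : Monotone acc)
    (h : (alive f : Set V).Pairwise fun u v => ¬ bad (alive f) u v) :
    HasSolution (IsAdmissible bad acc) f ↔ acc #(alive f) :=
  ⟨fun ⟨_, hS, hf⟩ => hacc (card_le_card hf.subset_alive) hS.2,
    fun hf => ⟨_, ⟨h, hf⟩, extends_alive⟩⟩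

theorem excludes_of_bad (hbad : ∀ u v, Antitone fun S => bad S u v) (huv : u ≠ v)
    (h : bad (alive f) u v) : Excludes (IsAdmissible bad acc) f u v :=
  fun _ hS hf ⟨hu, hv⟩ => hS.1 hu hv huv (hbad u v hf.subset_alive h)

end Admissible

end TwoClub

namespace WordRAM

open Finset TwoClub

/-! ### Memory layout -/

namespace Reg

@[simp] abbrev size : ℕ := 0
@[simp] abbrev param : ℕ := 1
@[simp] abbrev target : ℕ := 2
@[simp] abbrev height : ℕ := 3
@[simp] abbrev found : ℕ := 4
@[simp] abbrev top : ℕ := 5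
@[simp] abbrev bad : ℕ := 6
@[simp] abbrev badFst : ℕ := 7
@[simp] abbrev badSnd : ℕ := 8
@[simp] abbrev fst : ℕ := 9
@[simp] abbrev snd : ℕ := 10
@[simp] abbrev answer : ℕ := 11
@[simp] abbrev index : ℕ := 12
@[simp] abbrev count : ℕ := 13

end Reg

namespace Arr

@[simp] abbrev graph : ℕ := 0
@[simp] abbrev stack : ℕ := 1
@[simp] abbrev set : ℕ := 2

end Arr

section Search

open scoped Classical in
/-- The memory `s` contains the graph `G` and the numbers `t` and `k`; machine words and loop bounds
suffice for the auxiliary data of the algorithms. -/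
structure Encodes {n : ℕ} (B N : ℕ) (G : SimpleGraph (Fin n)) (t k : ℕ) (s : Store) : Prop where
  word : 16 * (n + 2) ^ 2 ≤ B
  loops : 2 * n ≤ N
  size : s.reg Reg.size = n
  param : s.reg Reg.param = t
  target : s.reg Reg.target = k
  graph : HoldsMatrix Arr.graph (fun u v => if G.Adj u v then 1 else 0) s

variable {B N n t k : ℕ} {G : SimpleGraph (Fin n)} {s s' : Store} {p : Prog}

theorem Encodes.frame (h : Encodes B N G t k s) (hf : Frame p s s')
    (hsize : p.writesReg Reg.size = false := by rfl)
    (hparam : p.writesReg Reg.param = false := by rfl)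
    (htarget : p.writesReg Reg.target = false := by rfl)
    (hgraph : p.writesArr Arr.graph = false := by rfl) : Encodes B N G t k s' where
  word := h.word
  loops := h.loops
  size := (hf.reg _ hsize).trans h.size
  param := (hf.reg _ hparam).trans h.param
  target := (hf.reg _ htarget).trans h.target
  graph := by simpa only [HoldsMatrix, HoldsRow, hf.arr _ hgraph] using h.graph

theorem Encodes.le_loops (h : Encodes B N G t k s) : n ≤ N :=
  (Nat.le_mul_of_pos_left n two_pos).trans h.loops

theorem Encodes.index_le (h : Encodes B N G t k s) {r : ℕ} (hr : r ≤ n + 1) (j : Fin n) :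
    r * n + j ≤ B := by
  have := h.word
  have := Nat.mul_le_mul_right n hr
  have := j.isLt
  nlinarith

theorem HoldsSet.frame {a : ℕ} {S : Finset (Fin n)} (h : HoldsSet a S s) (hf : Frame p s s')
    (ha : p.writesArr a = false := by rfl) : HoldsSet a S s' := by
  simpa only [HoldsSet, hf.arr a ha] using h

theorem HoldsSet.decides {a : ℕ} {S : Finset (Fin n)} {e : Expr} {v : Fin n} (h : HoldsSet a S s)
    (he : e.HasValue B s v) : (Expr.cell a e).Decides B s (v ∈ S) :=
  (he.cell (h v)).decides

/-- The program `p` tests whether the pair of vertices `u`, `v` in the registers `Reg.fst` and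
`Reg.snd` is bad in the set in array `Arr.set`, and it leaves the data of the search alone. -/
structure IsTest (bad : ∀ n, SimpleGraph (Fin n) → ℕ → Finset (Fin n) → Fin n → Fin n → Prop)
    (p : Prog) : Prop where
  reg : ∀ i < 20, i ≠ Reg.answer → p.writesReg i = false
  arr : ∀ a < 3, p.writesArr a = false
  decides : ∀ {B N n t k} {G : SimpleGraph (Fin n)} {S : Finset (Fin n)} {u v : Fin n} {s : Store},
    Encodes B N G t k s → HoldsSet Arr.set S s → s.reg Reg.fst = u → s.reg Reg.snd = v →
      u ∈ S → v ∈ S → u ≠ v →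
        WP B N p (fun s' => Expr.Decides B s' Reg.answer (bad n G t S u v)) s

/-! ### Finding a bad pair -/

/-- Put the vertices that are alive at the node in row `Reg.top` of the stack into `Arr.set`. -/
def loadSet : Prog :=
  .forLoop Reg.index Reg.size
    (.store Arr.set Reg.index (0 <ₑ .cell Arr.stack (Reg.top * Reg.size + Reg.index)))

theorem wp_loadSet (hE : Encodes B N G t k s) {r : ℕ} (hr : r ≤ n) (htop : s.reg Reg.top = r)
    {f : Fin n → ℕ} (hrow : HoldsRow Arr.stack r f s) :
    WP B N loadSet (HoldsSet Arr.set (alive f)) s := by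
  refine (WP.fillRow (r := 0) (f := fun v => if v ∈ alive f then 1 else 0) hE.size hE.le_loops
    (fun j s' _ hj => .reg (by simpa using hj)) fun j s' hf _ hj => ?_).mono
      fun s' _ h v => by simpa using h.1 v
  have hlabel : s'.arr Arr.stack (r * n + j) = f j := by
    rw [hf.arr _ rfl, hrow j]
  have hcell := Expr.HasValue.cell (.index (.reg ((hf.reg _ rfl).trans htop))
    ((hE.frame hf).size) (.reg hj) (hE.index_le (by omega) j)) hlabel
  exact ((Expr.HasValue.zero.lt hcell).congr (by simp [alive, pos_iff_ne_zero])).hasValue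

/-- Search for a pair of elements of the set in `Arr.set` for which `test` answers yes. -/
def findBad (test : Prog) : Prog :=
  .set Reg.bad 0 ;;
  .forPairs Reg.fst Reg.snd Reg.size
    (.cond (.cell Arr.set Reg.fst * .cell Arr.set Reg.snd * ((Reg.fst =ₑ Reg.snd) =ₑ 0))
      (test ;;
        .cond Reg.answer
          (.set Reg.bad 1 ;; .set Reg.badFst Reg.fst ;; .set Reg.badSnd Reg.snd)
          .skip)
      .skip)

/-- The outcome of the search for a pair in `D` with the property `P`. -/
def IsSearched (P : Fin n → Fin n → Prop) (D : Finset (Fin n × Fin n)) (s : Store) : Prop :=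
  (s.reg Reg.bad = 0 ∧ ∀ x ∈ D, ¬ P x.1 x.2) ∨
    (s.reg Reg.bad = 1 ∧ ∃ u v : Fin n, s.reg Reg.badFst = u ∧ s.reg Reg.badSnd = v ∧ P u v)

theorem IsSearched.frame {D : Finset (Fin n × Fin n)} {P : Fin n → Fin n → Prop}
    (h : IsSearched P D s) (hf : Frame p s s') (hbad : p.writesReg Reg.bad = false)
    (hfst : p.writesReg Reg.badFst = false) (hsnd : p.writesReg Reg.badSnd = false) :
    IsSearched P D s' := by
  simpa only [IsSearched, hf.reg _ hbad, hf.reg _ hfst, hf.reg _ hsnd] using h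

theorem IsSearched.insert {D : Finset (Fin n × Fin n)} {P : Fin n → Fin n → Prop}
    {x : Fin n × Fin n} (h : IsSearched P D s) (hx : ¬ P x.1 x.2) :
    IsSearched P (insert x D) s :=
  h.imp_left fun h => ⟨h.1, by simpa [hx] using h.2⟩

variable {bad : ∀ n, SimpleGraph (Fin n) → ℕ → Finset (Fin n) → Fin n → Fin n → Prop} {test : Prog}

theorem wp_record {D : Finset (Fin n × Fin n)} {P : Fin n → Fin n → Prop} {u v : Fin n}
    (hu : s.reg Reg.fst = u) (hv : s.reg Reg.snd = v) (hP : P u v) :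
    WP B N (.set Reg.bad 1 ;; .set Reg.badFst Reg.fst ;; .set Reg.badSnd Reg.snd)
      (IsSearched P D) s := by
  refine .bind (.assign .one) fun s₁ h₁ hbad => ?_
  refine .bind (.assign (.reg ((h₁.reg _ rfl).trans hu))) fun s₂ h₂ hfst => ?_
  refine (WP.assign (.reg ((h₂.reg _ rfl).trans ((h₁.reg _ rfl).trans hv)))).mono
    fun s₃ h₃ hsnd => ?_
  exact .inr ⟨(h₃.reg _ rfl).trans ((h₂.reg _ rfl).trans hbad), u, v,
    (h₃.reg _ rfl).trans hfst, hsnd, hP⟩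

theorem wp_findBad (ht : IsTest bad test) (hE : Encodes B N G t k s) {S : Finset (Fin n)}
    (hS : HoldsSet Arr.set S s) : WP B N (findBad test)
      (IsSearched (fun u v => u ∈ S ∧ v ∈ S ∧ u ≠ v ∧ bad n G t S u v) univ) s := by
  refine .bind (.assign .zero) fun s₀ h₀ hbad => ?_
  have hE₀ := hE.frame h₀
  have hS₀ := hS.frame h₀
  refine WP.forPairs _ hE₀.size hE₀.le_loops (.inl ⟨hbad, by simp⟩) ?_
    (hpi := by simp [ht.reg]) (hpj := by simp [ht.reg]) (hpb := by simp [ht.reg])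
  intro D ⟨u, v⟩ s₁ h₁ hu hv hD
  have hE₁ := hE₀.frame h₁ (by simp [ht.reg]) (by simp [ht.reg]) (by simp [ht.reg])
    (by simp [ht.arr])
  have hS₁ := hS₀.frame h₁ (by simp [ht.arr])
  refine .cond (((hS₁.decides (.reg hu)).and (hS₁.decides (.reg hv))).and
    (.not (.eq (.reg hu) (.reg hv)))) (fun h => ?_) fun h => .skip ?_
  · obtain ⟨⟨huS, hvS⟩, huv⟩ := h
    refine .bind (ht.decides hE₁ hS₁ hu hv huS hvS (Fin.val_ne_iff.1 huv)) fun s₂ h₂ hanswer => ?_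
    refine .cond hanswer (fun hP => ?_) fun hP => .skip ?_
    · exact wp_record ((h₂.reg _ (by simp [ht.reg])).trans hu)
        ((h₂.reg _ (by simp [ht.reg])).trans hv) ⟨huS, hvS, Fin.val_ne_iff.1 huv, hP⟩
    · exact (hD.frame h₂ (by simp [ht.reg]) (by simp [ht.reg]) (by simp [ht.reg])).insert
        fun hP' => hP hP'.2.2.2
  · exact hD.insert fun hP => h ⟨⟨hP.1, hP.2.1⟩, Fin.val_ne_iff.2 hP.2.2.1⟩

/-! ### The stack of the search tree -/

/-- The rows of array `Arr.stack` are the nodes in the list `l`, the head of which is the top of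
the stack. Since every undecided vertex of a node accounts for at most one node above it, there is
room for `n + 1` rows. -/
def HoldsStack : List (Fin n → ℕ) → Store → Prop
  | [], _ => True
  | f :: l, s => HoldsRow Arr.stack l.length f s ∧ #(undecided f) + l.length ≤ n ∧ HoldsStack l s

theorem HoldsRow.congr {a r : ℕ} {f : Fin n → ℕ} (h : HoldsRow a r f s)
    (heq : ∀ i < (r + 1) * n, s'.arr a i = s.arr a i) : HoldsRow a r f s' :=
  fun j => (heq _ (by rw [add_one_mul]; omega)).trans (h j)

theorem HoldsStack.congr {l : List (Fin n → ℕ)} (h : HoldsStack l s)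
    (heq : ∀ i < l.length * n, s'.arr Arr.stack i = s.arr Arr.stack i) : HoldsStack l s' := by
  induction l with
  | nil => trivial
  | cons f l ih =>
    exact ⟨h.1.congr heq, h.2.1, ih h.2.2 fun i hi => heq i (hi.trans_le (by
      rw [List.length_cons, add_one_mul]; omega))⟩

theorem HoldsStack.congr_arr {l : List (Fin n → ℕ)} (h : HoldsStack l s)
    (heq : s'.arr Arr.stack = s.arr Arr.stack) : HoldsStack l s' :=
  h.congr fun i _ => congrFun heq i

/-- The label of the vertex in register `i` in the row of the stack whose number is in
register `r`. -/
def label (r i : ℕ) : Expr := .cell Arr.stack (r * Reg.size + i)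

/-- Change the label of the vertex in register `i` in the row whose number is in register `r`. -/
def setLabel (r i c : ℕ) : Prog := .store Arr.stack (r * Reg.size + i) (.const c)

theorem hasValue_label (hE : Encodes B N G t k s) {r i x : ℕ} {f : Fin n → ℕ} {v : Fin n}
    (hr : s.reg r = x) (hx : x ≤ n + 1) (hi : s.reg i = v) (h : HoldsRow Arr.stack x f s) :
    (label r i).HasValue B s (f v) :=
  .cell (.index (.reg hr) hE.size (.reg hi) (hE.index_le hx v)) (h v)

theorem wp_setLabel (hE : Encodes B N G t k s) {r i x c : ℕ} {v : Fin n}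
    (hr : s.reg r = x) (hx : x ≤ n + 1) (hi : s.reg i = v) (hc : c ≤ 2) :
    WP B N (setLabel r i c)
      (fun s' => s'.arr Arr.stack = Function.update (s.arr Arr.stack) (x * n + v) c) s := by
  have := hE.word
  exact .write (.index (.reg hr) hE.size (.reg hi) (hE.index_le hx v)) (.const (by nlinarith))

/-! ### One step of the search -/

theorem HoldsStack.update {f : Fin n → ℕ} {l : List (Fin n → ℕ)} {v : Fin n} {c : ℕ}
    (h : HoldsStack (f :: l) s) (hv : f v = 1) (hc : c ≠ 1)
    (hs' : s'.arr Arr.stack = Function.update (s.arr Arr.stack) (l.length * n + v) c) :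
    HoldsStack (Function.update f v c :: l) s' := by
  refine ⟨h.1.update hs', ?_, h.2.2.congr fun i hi => ?_⟩
  · have := card_undecided_update hv hc
    have := h.2.1
    omega
  · rw [hs', Function.update_of_ne (by omega)]

/-- The invariant of the search for a set with the property `Φ`: there is one if and only if one
has been found or there is one below some node of the stack `l`. -/
structure SearchState (B N : ℕ) (G : SimpleGraph (Fin n)) (t k : ℕ) (Φ : Finset (Fin n) → Prop)
    (l : List (Fin n → ℕ)) (s : Store) : Prop where
  input : Encodes B N G t k s
  height : s.reg Reg.height = l.length
  stack : HoldsStack l s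
  correct : (s.reg Reg.found ≠ 0 ∨ ∃ f ∈ l, HasSolution Φ f) ↔ ∃ S, Φ S

variable {Φ : Finset (Fin n) → Prop} {f : Fin n → ℕ} {l : List (Fin n → ℕ)} {u v : Fin n}

theorem SearchState.frame (h : SearchState B N G t k Φ l s) (hf : Frame p s s')
    (hreg : ∀ i < 5, p.writesReg i = false) (hgraph : p.writesArr Arr.graph = false)
    (hstack : p.writesArr Arr.stack = false) : SearchState B N G t k Φ l s' where
  input := h.input.frame hf (hreg _ (by decide)) (hreg _ (by decide)) (hreg _ (by decide)) hgraph
  height := (hf.reg _ (hreg _ (by decide))).trans h.height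
  stack := h.stack.congr_arr (hf.arr _ hstack)
  correct := by simpa only [hf.reg _ (hreg Reg.found (by decide))] using h.correct

theorem wp_pop (h : SearchState B N G t k Φ (f :: l) s) (htop : s.reg Reg.top = l.length)
    (hsol : HasSolution Φ f → s.reg Reg.found ≠ 0) :
    WP B N (.set Reg.height Reg.top) (SearchState B N G t k Φ l) s := by
  refine (WP.assign (.reg htop)).mono fun s' hf hheight =>
    ⟨h.input.frame hf, hheight, h.stack.2.2.congr_arr (hf.arr _ rfl), ?_⟩
  rw [hf.reg _ rfl, ← h.correct, List.exists_mem_cons_iff, ← or_assoc, or_iff_left_of_imp hsol]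

theorem wp_delete (h : SearchState B N G t k Φ (f :: l) s) (htop : s.reg Reg.top = l.length)
    {i : ℕ} (hi : s.reg i = v) (hv : f v = 1)
    (hsol : HasSolution Φ f ↔ HasSolution Φ (Function.update f v 0)) :
    WP B N (setLabel Reg.top i 0) (SearchState B N G t k Φ (Function.update f v 0 :: l)) s := by
  have hroom := h.stack.2.1
  refine (wp_setLabel h.input htop (by omega) hi (by decide)).mono fun s' hf hs' =>
    ⟨h.input.frame hf, (hf.reg _ rfl).trans h.height, h.stack.update hv zero_ne_one hs', ?_⟩
  simpa only [hf.reg Reg.found rfl, List.exists_mem_cons_iff, hsol] using h.correct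

/-- Copy the top of the stack to the row above it. -/
def copyTop : Prog :=
  .forLoop Reg.index Reg.size
    (.store Arr.stack (Reg.height * Reg.size + Reg.index) (label Reg.top Reg.index))

/-- Replace the top of the stack by two nodes, where the first vertex of the bad pair is deleted at
one of them, and is kept while the second vertex is deleted at the other one. -/
def branch : Prog :=
  copyTop ;; setLabel Reg.top Reg.badFst 0 ;;
    (setLabel Reg.height Reg.badFst 2 ;; setLabel Reg.height Reg.badSnd 0) ;;
    .set Reg.height (Reg.height + 1)

theorem wp_copyTop (h : SearchState B N G t k Φ (f :: l) s) (htop : s.reg Reg.top = l.length) :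
    WP B N copyTop
      (fun s' => HoldsRow Arr.stack (l.length + 1) f s' ∧ HoldsStack (f :: l) s') s := by
  have hroom := h.stack.2.1
  refine (WP.fillRow h.input.size h.input.le_loops (fun j s' hf hj => ?_)
    fun j s' hf hlow hj => ?_).mono fun s' _ h' => ⟨h'.1, h.stack.congr h'.2⟩
  · exact .index (.reg ((hf.reg _ rfl).trans h.height)) (h.input.frame hf).size (.reg hj)
      (h.input.index_le (by omega) j)
  · exact hasValue_label (h.input.frame hf) ((hf.reg _ rfl).trans htop) (by omega) hj
      (h.stack.1.congr hlow)

theorem wp_keepFst (hE : Encodes B N G t k s) (hheight : s.reg Reg.height = l.length)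
    (hfst : s.reg Reg.badFst = u) (hsnd : s.reg Reg.badSnd = v) (huv : u ≠ v) (hu : f u = 1)
    (hv : f v = 1) (hroom : #(undecided f) + l.length ≤ n + 1)
    (hrow : HoldsRow Arr.stack l.length f s) (hstack : HoldsStack l s) :
    WP B N (setLabel Reg.height Reg.badFst 2 ;; setLabel Reg.height Reg.badSnd 0)
      (HoldsStack (Function.update (Function.update f u 2) v 0 :: l)) s := by
  have hl : l.length ≤ n + 1 := by omega
  refine .bind (wp_setLabel hE hheight hl hfst le_rfl) fun s₁ h₁ hs₁ => ?_
  refine (wp_setLabel (hE.frame h₁) ((h₁.reg _ rfl).trans hheight) hl ((h₁.reg _ rfl).trans hsnd)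
    (by decide)).mono fun s₂ _ hs₂ => HoldsStack.update ⟨hrow.update hs₁, ?_, ?_⟩ ?_ zero_ne_one hs₂
  · have := card_undecided_update (c := 2) hu (by decide)
    omega
  · exact hstack.congr fun i hi => by rw [hs₁, Function.update_of_ne (by omega)]
  · rwa [Function.update_of_ne huv.symm]

theorem wp_branch (h : SearchState B N G t k Φ (f :: l) s) (htop : s.reg Reg.top = l.length)
    (hfst : s.reg Reg.badFst = u) (hsnd : s.reg Reg.badSnd = v) (huv : u ≠ v)
    (hu : f u = 1) (hv : f v = 1)
    (hsol : HasSolution Φ f ↔ HasSolution Φ (Function.update f u 0) ∨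
      HasSolution Φ (Function.update (Function.update f u 2) v 0)) :
    WP B N branch (SearchState B N G t k Φ
      (Function.update (Function.update f u 2) v 0 :: Function.update f u 0 :: l)) s := by
  have hroom := h.stack.2.1
  have hE := h.input
  refine .bind (wp_copyTop h htop) fun s₁ h₁ ⟨hrow₁, hstack₁⟩ => ?_
  refine .bind (wp_setLabel (hE.frame h₁) ((h₁.reg _ rfl).trans htop) (by omega)
    ((h₁.reg _ rfl).trans hfst) (by decide)) fun s₂ h₂ hs₂ => ?_
  have h₁₂ {i} (hi : copyTop.writesReg i = false) : s₂.reg i = s.reg i :=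
    (h₂.reg i rfl).trans (h₁.reg i hi)
  have hE₂ := (hE.frame h₁).frame h₂
  refine .bind (wp_keepFst (l := Function.update f u 0 :: l) hE₂ ((h₁₂ rfl).trans h.height)
    ((h₁₂ rfl).trans hfst) ((h₁₂ rfl).trans hsnd) huv hu hv (by simp only [List.length_cons]; omega)
    (hrow₁.update_other (Nat.succ_ne_self _) hs₂) (hstack₁.update hu zero_ne_one hs₂))
    fun s₃ h₃ hstack₃ => ?_
  have hheight₃ : s₃.reg Reg.height = l.length + 1 :=
    ((h₃.reg _ rfl).trans (h₁₂ rfl)).trans h.height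
  have hword := hE.word
  refine (WP.assign ((Expr.HasValue.reg hheight₃).add .one (by nlinarith))).mono
    fun s₄ h₄ hheight => ⟨(hE₂.frame h₃).frame h₄, hheight, hstack₃.congr_arr (h₄.arr _ rfl), ?_⟩
  rw [h₄.reg _ rfl, h₃.reg _ rfl, h₁₂ rfl, ← h.correct]
  simp only [List.exists_mem_cons_iff, hsol]
  tauto

end Search

end WordRAM

namespace WordRAM

open Finset TwoClub Polynomial Asymptotics Filter

section Search

variable {B N n t k : ℕ} {G : SimpleGraph (Fin n)} {s s' : Store} {p : Prog}
  {Φ : Finset (Fin n) → Prop} {f : Fin n → ℕ} {l : List (Fin n → ℕ)} {u v : Fin n}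

/-- Settle the bad pair in the registers `Reg.badFst` and `Reg.badSnd` at the top of the stack. -/
def resolve : Prog :=
  .cond (1 <ₑ label Reg.top Reg.badFst)
    (.cond (1 <ₑ label Reg.top Reg.badSnd) (.set Reg.height Reg.top)
      (setLabel Reg.top Reg.badSnd 0))
    (.cond (1 <ₑ label Reg.top Reg.badSnd) (setLabel Reg.top Reg.badFst 0) branch)

theorem wp_resolve (h : SearchState B N G t k Φ (f :: l) s) (htop : s.reg Reg.top = l.length)
    (hfst : s.reg Reg.badFst = u) (hsnd : s.reg Reg.badSnd = v) (huv : u ≠ v)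
    (hu : u ∈ alive f) (hv : v ∈ alive f) (hex : Excludes Φ f u v) :
    WP B N resolve (fun s' => ∃ l', (l'.map weight).sum < ((f :: l).map weight).sum ∧
      SearchState B N G t k Φ l' s') s := by
  have hroom := h.stack.2.1
  have hlabel {i w} (hi : s.reg i = (w : Fin n)) :
      (1 <ₑ label Reg.top i).Decides B s (1 < f w) :=
    .lt .one (hasValue_label h.input htop (by omega) hi h.stack.1)
  have hone {w} (hw : w ∈ alive f) (hlt : ¬ 1 < f w) : f w = 1 := by
    simp only [alive, mem_filter_univ] at hw
    omega
  refine .cond (hlabel hfst) (fun hu2 => ?_) fun hu2 => ?_ <;>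
    refine .cond (hlabel hsnd) (fun hv2 => ?_) fun hv2 => ?_
  · exact (wp_pop h htop fun hsol => (hex.not_hasSolution hu2 hv2 hsol).elim).mono
      fun s' _ h' => ⟨_, by simpa using weight_pos, h'⟩
  · exact (wp_delete h htop hsnd (hone hv hv2) (hex.hasSolution_iff_delete hu2 (hone hv hv2))).mono
      fun s' _ h' => ⟨_, by simpa using weight_update_lt (hone hv hv2) zero_ne_one, h'⟩
  · exact (wp_delete h htop hfst (hone hu hu2)
      (hex.symm.hasSolution_iff_delete hv2 (hone hu hu2))).mono
        fun s' _ h' => ⟨_, by simpa using weight_update_lt (hone hu hu2) zero_ne_one, h'⟩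
  · refine (wp_branch h htop hfst hsnd huv (hone hu hu2) (hone hv hv2)
      (hex.hasSolution_iff_branch huv (hone hu hu2) (hone hv hv2))).mono fun s' _ h' => ⟨_, ?_, h'⟩
    have := weight_branch_lt huv (hone hu hu2) (hone hv hv2)
    simp only [List.map_cons, List.sum_cons]
    omega

/-- Accept the set in array `Arr.set` if its size satisfies the test `e`, and remove the top of the
stack. -/
def accept (e : Expr) : Prog :=
  .countLoop Reg.index Reg.size Reg.count (.cell Arr.set Reg.index) ;;
    .cond e (.set Reg.found 1) .skip ;; .set Reg.height Reg.top

/-- The expression `e` tests whether the number in the register `Reg.count` is large enough. -/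
def IsSizeTest (acc : ℕ → ℕ → ℕ → Prop) (e : Expr) : Prop :=
  ∀ {B : ℕ} {s : Store} {t k m : ℕ}, s.reg Reg.param = t → s.reg Reg.target = k →
    s.reg Reg.count = m → e.Decides B s (acc t k m)

variable {acc : ℕ → ℕ → ℕ → Prop} {e : Expr}

theorem wp_accept (he : IsSizeTest acc e) (h : SearchState B N G t k Φ (f :: l) s)
    (htop : s.reg Reg.top = l.length) (hS : HoldsSet Arr.set (alive f) s)
    (hsol : HasSolution Φ f ↔ acc t k #(alive f)) :
    WP B N (accept e) (SearchState B N G t k Φ l) s := by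
  refine .bind (.countLoop h.input.size h.input.le_loops fun j s' hf hj =>
    (hS.frame hf).decides (.reg hj)) fun s₁ h₁ hcount => ?_
  rw [filter_univ_mem] at hcount
  have hs₁ := h.frame h₁ (by decide) rfl rfl
  have htop₁ : s₁.reg Reg.top = l.length := (h₁.reg _ rfl).trans htop
  refine .bind (P := fun s₂ => SearchState B N G t k Φ (f :: l) s₂ ∧ s₂.reg Reg.top = l.length ∧
    (HasSolution Φ f → s₂.reg Reg.found ≠ 0)) (.cond (he hs₁.input.param hs₁.input.target hcount)
      (fun hacc => ?_) fun hacc => .skip ⟨hs₁, htop₁, fun hf => (hacc (hsol.1 hf)).elim⟩)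
    fun s₂ _ hs₂ => wp_pop hs₂.1 hs₂.2.1 hs₂.2.2
  refine (WP.assign .one).mono fun s₂ h₂ hfound => ?_
  have hne : s₂.reg Reg.found ≠ 0 := by simp only [hfound, ne_eq, one_ne_zero, not_false_eq_true]
  obtain ⟨S, hS, -⟩ := hsol.2 hacc
  exact ⟨⟨hs₁.input.frame h₂, (h₂.reg _ rfl).trans hs₁.height, hs₁.stack.congr_arr (h₂.arr _ rfl),
    iff_of_true (.inl hne) ⟨S, hS⟩⟩, (h₂.reg _ rfl).trans htop₁, fun _ => hne⟩

/-- Deal with the node at the top of the stack. -/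
def expand (test : Prog) (e : Expr) : Prog :=
  .set Reg.top (Reg.height - 1) ;; loadSet ;; findBad test ;; .cond Reg.bad resolve (accept e)

variable {bad : ∀ n, SimpleGraph (Fin n) → ℕ → Finset (Fin n) → Fin n → Fin n → Prop} {test : Prog}

theorem wp_expand (ht : IsTest bad test) (he : IsSizeTest acc e)
    (hbad : ∀ u v, Antitone fun S => bad n G t S u v) (hacc : Monotone (acc t k))
    (h : SearchState B N G t k (IsAdmissible (bad n G t) (acc t k)) (f :: l) s) :
    WP B N (expand test e) (fun s' => ∃ l', (l'.map weight).sum < ((f :: l).map weight).sum ∧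
      SearchState B N G t k (IsAdmissible (bad n G t) (acc t k)) l' s') s := by
  refine .bind (.assign (.sub (.reg h.height) .one)) fun s₁ h₁ htop => ?_
  have htop₁ : s₁.reg Reg.top = l.length := htop
  have hs₁ := h.frame h₁ (by decide) rfl rfl
  have hroom := h.stack.2.1
  refine .bind (wp_loadSet hs₁.input (by omega) htop₁ hs₁.stack.1) fun s₂ h₂ hS₂ => ?_
  have hs₂ := hs₁.frame h₂ (by decide) rfl rfl
  refine .bind (wp_findBad ht hs₂.input hS₂) fun s₃ h₃ hfind => ?_
  have hs₃ := hs₂.frame h₃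
    (fun i hi => by simp [findBad, ht.reg i (by omega) (by simp; omega)]; omega)
    (by simp [findBad, ht.arr]) (by simp [findBad, ht.arr])
  have htop₃ : s₃.reg Reg.top = l.length :=
    ((h₃.reg _ (by simp [findBad, ht.reg])).trans (h₂.reg _ rfl)).trans htop₁
  rcases hfind with ⟨hb, hnone⟩ | ⟨hb, u, v, hfst, hsnd, hu, hv, huv, hP⟩
  · refine .cond (c := False) (.decides (.reg (by simpa using hb))) False.elim fun _ => ?_
    refine (wp_accept he hs₃ htop₃ (hS₂.frame h₃ (by simp [findBad, ht.arr]))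
      (hasSolution_iff_acc hacc fun u hu v hv huv hP =>
        hnone (u, v) (mem_univ _) ⟨hu, hv, huv, hP⟩)).mono
          fun s' _ h' => ⟨l, by simpa using weight_pos, h'⟩
  · refine .cond (c := True) (.decides (.reg (by simpa using hb))) (fun _ => ?_)
      fun h => (h trivial).elim
    exact wp_resolve hs₃ htop₃ hfst hsnd huv hu hv (excludes_of_bad hbad huv hP)

/-- Put the root of the search tree on the stack. -/
def initStack : Prog :=
  .forLoop Reg.index Reg.size (.store Arr.stack Reg.index 1) ;; .set Reg.height 1

theorem wp_initStack (hE : Encodes B N G t k s) (hfound : s.reg Reg.found = 0) :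
    WP B N initStack (SearchState B N G t k Φ [fun _ => 1]) s := by
  refine .bind (WP.fillRow (r := 0) (f := fun _ => 1) hE.size hE.le_loops
    (fun j s' _ hj => .reg (by simpa using hj)) fun _ _ _ _ _ => .one) fun s₁ h₁ hrow => ?_
  refine (WP.assign .one).mono fun s₂ h₂ hheight =>
    ⟨(hE.frame h₁).frame h₂, hheight, ⟨?_, by simp [undecided], trivial⟩, ?_⟩
  · simpa only [HoldsRow, List.length_nil, h₂.arr Arr.stack rfl] using hrow.1
  · have hfound₂ : s₂.reg Reg.found = 0 := ((h₂.reg _ rfl).trans (h₁.reg _ rfl)).trans hfound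
    rw [hfound₂]
    simp [HasSolution, Extends]

/-- The search algorithm for sets without bad pairs that are large enough. -/
def solver (test : Prog) (e : Expr) : Prog :=
  initStack ;; .loop Reg.height (expand test e) ;; .set 0 (0 <ₑ Reg.found)

theorem exists_exec_search (ht : IsTest bad test) (he : IsSizeTest acc e)
    (hbad : ∀ u v, Antitone fun S => bad n G t S u v) (hacc : Monotone (acc t k))
    (h : SearchState B N G t k (IsAdmissible (bad n G t) (acc t k)) l s) (hs : s.Bounded B) :
    ∃ τ s', Exec B (.loop Reg.height (expand test e)) s τ s' ∧
      τ ≤ ((l.map weight).sum + 1) * (2 + (expand test e).time.eval N) ∧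
      SearchState B N G t k (IsAdmissible (bad n G t) (acc t k)) [] s' ∧ s'.Bounded B := by
  let J (m : ℕ) (s : Store) : Prop := ∃ l, (l.map weight).sum = m ∧
    SearchState B N G t k (IsAdmissible (bad n G t) (acc t k)) l s ∧ s.Bounded B
  have step (m : ℕ) (s : Store) (hJ : J m s) (hne : s.reg Reg.height ≠ 0) :
      ∃ τ s' m', Exec B (expand test e) s τ s' ∧ τ ≤ (expand test e).time.eval N ∧ m' < m ∧
        J m' s' := by
    obtain ⟨l, rfl, hl, hs⟩ := hJ
    obtain ⟨f, l, rfl⟩ := List.exists_cons_of_length_pos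
      (Nat.pos_of_ne_zero fun h0 => hne (hl.height.trans h0))
    obtain ⟨τ, s', hexec, hτ, hs', l', hlt, hl'⟩ := wp_expand ht he hbad hacc hl hs
    exact ⟨τ, s', _, hexec, hτ, hlt, l', rfl, hl', hs'⟩
  obtain ⟨τ, s', -, hexec, hτ, ⟨l', -, hl', hs'⟩, hzero⟩ := Exec.exists_loop (e := Reg.height)
    (fun m s ⟨_, _, _, hs⟩ => hs.reg _) step _ s ⟨l, rfl, h, hs⟩
  obtain rfl : l' = [] := List.length_eq_zero_iff.1 (hl'.height.symm.trans hzero)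
  exact ⟨τ, s', hexec, hτ, hl', hs'⟩

open scoped Classical in
theorem exists_exec_solver (ht : IsTest bad test) (he : IsSizeTest acc e)
    (hbad : ∀ u v, Antitone fun S => bad n G t S u v) (hacc : Monotone (acc t k))
    (hE : Encodes B N G t k s) (hfound : s.reg Reg.found = 0) (hs : s.Bounded B) :
    ∃ τ s', Exec B (solver test e) s τ s' ∧ τ ≤ Nat.fib (n + 3) * (solver test e).time.eval N ∧
      s'.reg 0 = if ∃ S, IsAdmissible (bad n G t) (acc t k) S then 1 else 0 := by
  obtain ⟨τ₁, s₁, h₁, hτ₁, hs₁, hinit⟩ := wp_initStack hE hfound hs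
  obtain ⟨τ₂, s₂, h₂, hτ₂, hl₂, hs₂⟩ := exists_exec_search ht he hbad hacc hinit hs₁
  have hfound₂ := (Expr.HasValue.zero.lt (.reg (B := B) (s := s₂) (i := Reg.found) rfl)).congr
    (by simpa [pos_iff_ne_zero] using hl₂.correct)
  obtain ⟨τ₃, s₃, h₃, hτ₃, -, hanswer⟩ := WP.assign (N := N) (i := 0) hfound₂.hasValue hs₂
  refine ⟨_, s₃, .seq h₁ (.seq h₂ h₃), ?_, hanswer⟩
  have hpos : 0 < Nat.fib (n + 3) := Nat.fib_pos.2 (by omega)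
  have hweight : weight (fun _ : Fin n => 1) + 1 = Nat.fib (n + 3) := by
    simp only [weight, undecided, filter_true, card_univ, Fintype.card_fin]
    omega
  rw [List.map_singleton, List.sum_singleton, hweight] at hτ₂
  have htime : (solver test e).time.eval N = initStack.time.eval N +
      ((N + 1) * (2 + (expand test e).time.eval N) +
        (Prog.set 0 (0 <ₑ Reg.found)).time.eval N) := by
    simp [solver, Prog.time, Expr.cost]
  rw [htime, mul_add, mul_add, ← mul_assoc]
  have := Nat.mul_le_mul_right (2 + (expand test e).time.eval N)
    (Nat.le_mul_of_pos_right (Nat.fib (n + 3)) (show 0 < N + 1 by omega))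
  have := Nat.le_mul_of_pos_left (initStack.time.eval N) hpos
  have := Nat.le_mul_of_pos_left ((Prog.set 0 (0 <ₑ Reg.found)).time.eval N) hpos
  omega

/-! ### The running time -/

theorem encodes_input (hB : 16 * (n + 2) ^ 2 ≤ B) : Encodes B (2 * n) G t k (input n G t k) where
  word := hB
  loops := le_rfl
  size := rfl
  param := rfl
  target := rfl
  graph i j := by
    have hiff : (0 = 0 ∧ ∃ i' j' : Fin n, (i : ℕ) * n + j = i' * n + j' ∧ G.Adj i' j') ↔
        G.Adj i j := by
      refine ⟨fun ⟨_, i', j', h, hadj⟩ => ?_, fun hadj => ⟨rfl, i, j, rfl, hadj⟩⟩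
      obtain ⟨hi, rfl⟩ := index_inj h
      rwa [Fin.ext hi]
    simp only [input]
    convert if_congr hiff rfl rfl

theorem bounded_input (hB : 1 ≤ B) (hn : n ≤ B) (ht : t ≤ B) (hk : k ≤ B) :
    (input n G t k).Bounded B :=
  ⟨hB, fun i => by simp only [input]; split_ifs <;> omega,
    fun a j => by simp only [input]; split_ifs <;> omega⟩

theorem isLittleO_eval_mul_pow (P : ℝ[X]) {a b : ℝ} (h : |a| < b) :
    (fun n : ℕ => P.eval (n : ℝ) * a ^ n) =o[atTop] fun n => b ^ n := by
  induction P using Polynomial.induction_on' with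
  | add P Q hP hQ => simpa only [eval_add, add_mul] using hP.add hQ
  | monomial d c =>
    simpa only [eval_monomial, mul_assoc] using
      (isLittleO_pow_const_mul_const_pow_const_pow_of_norm_lt d h).const_mul_left c

theorem fib_le_goldenRatio_pow (n : ℕ) : (Nat.fib (n + 1) : ℝ) ≤ Real.goldenRatio ^ n := by
  have h := Real.goldenRatio_mul_fib_succ_add_fib n
  rw [pow_succ'] at h
  refine le_of_mul_le_mul_left ?_ Real.goldenRatio_pos
  linarith [(Nat.fib n).cast_nonneg (α := ℝ)]

theorem goldenRatio_lt : Real.goldenRatio < 1.62 := by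
  have : √5 < 2.24 := by rw [Real.sqrt_lt' (by norm_num)]; norm_num
  rw [Real.goldenRatio]
  linarith

theorem isBigO_fib_mul_eval (P : ℕ[X]) :
    (fun n => ((Nat.fib (n + 3) * P.eval (2 * n) : ℕ) : ℝ)) =O[atTop] fun n => (1.62 : ℝ) ^ n := by
  have hpoly := (isLittleO_eval_mul_pow ((P.map (Nat.castRingHom ℝ)).comp (2 * X))
    ((abs_of_pos Real.goldenRatio_pos).trans_lt goldenRatio_lt)).isBigO.const_mul_left
      (Real.goldenRatio ^ 2)
  refine .trans (.of_norm_le fun n => ?_) hpoly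
  have hfib : (Nat.fib (n + 3) : ℝ) ≤ Real.goldenRatio ^ 2 * Real.goldenRatio ^ n := by
    simpa only [← pow_add, add_comm 2 n] using fib_le_goldenRatio_pow (n + 2)
  have heval :
      ((P.map (Nat.castRingHom ℝ)).comp (2 * X)).eval (n : ℝ) = (P.eval (2 * n) : ℕ) := by
    simpa using Polynomial.eval_natCast_map (Nat.castRingHom ℝ) P (2 * n)
  rw [heval, Real.norm_natCast, Nat.cast_mul, mul_left_comm, mul_comm]
  gcongr

theorem solvableInTimeO_of_isTest {Q : Problem} (ht : IsTest bad test) (he : IsSizeTest acc e)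
    (hbad : ∀ n G t u v, Antitone fun S => bad n G t S u v) (hacc : ∀ t k, Monotone (acc t k))
    (hQ : ∀ n G t k, Q n G t k ↔ ∃ S, IsAdmissible (bad n G t) (acc t k) S) :
    SolvableInTimeO Q fun n => 1.62 ^ n := by
  refine ⟨solver test e, _, ⟨6, fun n G t k => ?_⟩, isBigO_fib_mul_eval (solver test e).time⟩
  have hB : 16 * (n + 2) ^ 2 ≤ (n + 2) ^ 6 + t + k := by
    have : 2 ^ 4 * (n + 2) ^ 2 ≤ (n + 2) ^ 4 * (n + 2) ^ 2 := by gcongr; omega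
    linarith
  have hn : n ≤ (n + 2) ^ 6 + t + k := by nlinarith
  obtain ⟨τ, s, hexec, hτ, hs⟩ := exists_exec_solver ht he (hbad n G t) (hacc t k)
    (encodes_input hB) rfl (bounded_input (by nlinarith) hn (by omega) (by omega))
  exact ⟨τ, s, hexec, hτ, by
    convert hs using 2
    exact hQ n G t k⟩

end Search

end WordRAM

namespace TwoClub

open Finset

/-! ### Obstructions to robust and hereditary 2-clubs -/

section Obstructions

variable {V : Type*} {G : SimpleGraph V} {t : ℕ} {S : Finset V} {u v : V}

theorem isTwoClub_iff {S : Set V} : IsTwoClub G S ↔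
    ∀ u ∈ S, ∀ v ∈ S, u ≠ v → ¬ G.Adj u v → ∃ w ∈ S, G.Adj u w ∧ G.Adj w v := by
  have hempty (u v : S) : (G.induce S).commonNeighbors u v = ∅ ↔
      ¬ ∃ w ∈ S, G.Adj u w ∧ G.Adj w v := by
    simp only [Set.eq_empty_iff_forall_notMem, SimpleGraph.mem_commonNeighbors, Subtype.forall,
      SimpleGraph.comap_adj, Function.Embedding.subtype_apply, G.adj_comm v]
    push Not
    rfl
  rw [IsTwoClub, SimpleGraph.ediam_le_iff]
  simp only [← not_lt, SimpleGraph.two_lt_edist_iff, hempty]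
  simp [Subtype.forall]

open scoped Classical in
/-- The common neighbours of `u` and `v` in `S`. -/
noncomputable def common (G : SimpleGraph V) (S : Finset V) (u v : V) : Finset V :=
  {w ∈ S | G.Adj u w ∧ G.Adj w v}

open scoped Classical in
/-- The second vertices of the paths of length at most two from `u` to `v` in `G[S]`. -/
noncomputable def detours (G : SimpleGraph V) (S : Finset V) (u v : V) : Finset V :=
  {w ∈ S | G.Adj u w ∧ (w = v ∨ G.Adj w v)}

@[simp]
theorem mem_common {w : V} : w ∈ common G S u v ↔ w ∈ S ∧ G.Adj u w ∧ G.Adj w v := by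
  simp [common]

@[simp]
theorem mem_detours {w : V} :
    w ∈ detours G S u v ↔ w ∈ S ∧ G.Adj u w ∧ (w = v ∨ G.Adj w v) := by
  simp [detours]

theorem common_mono : Monotone fun S => common G S u v := by
  classical exact fun _ _ h => filter_subset_filter _ h

theorem detours_mono : Monotone fun S => detours G S u v := by
  classical exact fun _ _ h => filter_subset_filter _ h

/-- The distance of `u` and `v` exceeds two after the deletion of some `t` vertices. -/
def IsHereditaryObstruction (t : ℕ) (G : SimpleGraph V) (S : Finset V) (u v : V) : Prop :=
  ¬ G.Adj u v ∧ #(common G S u v) ≤ t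

/-- Fewer than `t` paths of length at most two connect `u` and `v` in `G[S]`. -/
def IsRobustObstruction (t : ℕ) (G : SimpleGraph V) (S : Finset V) (u v : V) : Prop :=
  #(detours G S u v) < t

theorem isHereditaryObstruction_antitone : Antitone fun S => IsHereditaryObstruction t G S u v :=
  fun _ _ h => And.imp_right (card_le_card (common_mono h)).trans

theorem isRobustObstruction_antitone : Antitone fun S => IsRobustObstruction t G S u v :=
  fun _ _ h => (card_le_card (detours_mono h)).trans_lt

theorem isHereditary_iff :
    IsHereditary t G S ↔ (S : Set V).Pairwise fun u v => ¬ IsHereditaryObstruction t G S u v := by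
  classical
  simp only [IsHereditary, isTwoClub_iff]
  constructor
  · rintro h u hu v hv huv ⟨hadj, hcard⟩
    obtain ⟨w, hw, huw, hwv⟩ := h (common G S u v) (filter_subset _ _) hcard u
      (by simpa using hu) v (by simpa using hv) huv hadj
    exact hw.2 (by simpa [huw, hwv] using hw.1)
  · rintro h U - hcard u hu v hv huv hadj
    by_contra! hw
    refine h hu.1 hv.1 huv ⟨hadj, (card_le_card fun w hwS => ?_).trans hcard⟩
    obtain ⟨hwS, huw, hwv⟩ := mem_common.1 hwS
    by_contra hwU
    exact hw w ⟨hwS, hwU⟩ huw hwv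

theorem exists_path_getVert_one {w : V} (huv : u ≠ v) (huw : G.Adj u w) (hwv : w = v ∨ G.Adj w v) :
    ∃ p : G.Path u v, p.1.length ≤ 2 ∧ p.1.getVert 1 = w := by
  rcases eq_or_ne w v with rfl | hne
  · exact ⟨⟨.cons huw .nil, by simp [SimpleGraph.Walk.isPath_def, huv]⟩, by simp⟩
  · exact ⟨⟨.cons huw (.cons (hwv.resolve_left hne) .nil), by
      simp [SimpleGraph.Walk.isPath_def, huv, huw.ne, hne]⟩, by simp⟩

theorem support_eq_of_length_le_two (huv : u ≠ v) {p : G.Walk u v} (hp : p.length ≤ 2) :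
    G.Adj u (p.getVert 1) ∧ (p.getVert 1 = v ∧ p.support = [u, v] ∨
      G.Adj (p.getVert 1) v ∧ p.support = [u, p.getVert 1, v]) := by
  rcases p with _ | ⟨huw, _ | ⟨hwv, _ | _⟩⟩
  · exact absurd rfl huv
  · simpa using huw
  · simp [huw, hwv]
  · simp at hp

theorem getVert_one_bijOn (huv : u ≠ v) :
    Set.BijOn (fun p : G.Path u v => p.1.getVert 1) {p | p.1.length ≤ 2}
      {w | G.Adj u w ∧ (w = v ∨ G.Adj w v)} := by
  refine ⟨fun p hp => ?_, fun p hp q hq hpq => ?_,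
    fun w hw => exists_path_getVert_one huv hw.1 hw.2⟩
  · obtain ⟨huw, h⟩ := support_eq_of_length_le_two huv hp
    exact ⟨huw, h.imp And.left And.left⟩
  · replace hpq : p.1.getVert 1 = q.1.getVert 1 := hpq
    obtain ⟨-, h⟩ := support_eq_of_length_le_two huv hp
    obtain ⟨-, h'⟩ := support_eq_of_length_le_two huv hq
    refine Subtype.ext (SimpleGraph.Walk.ext_support ?_)
    rcases h with ⟨hp, h⟩ | ⟨hp, h⟩ <;> rcases h' with ⟨hq, h'⟩ | ⟨hq, h'⟩ <;> simp_all

theorem internallyDisjoint_of_ne (huv : u ≠ v) {p q : G.Path u v} (hp : p.1.length ≤ 2)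
    (hq : q.1.length ≤ 2) (hpq : p ≠ q) : InternallyDisjoint p q := by
  intro x hxp hxq
  have hne : p.1.getVert 1 ≠ q.1.getVert 1 :=
    fun h => hpq ((getVert_one_bijOn huv).injOn hp hq h)
  rcases (support_eq_of_length_le_two huv hp).2 with ⟨-, h⟩ | ⟨-, h⟩ <;>
  rcases (support_eq_of_length_le_two huv hq).2 with ⟨-, h'⟩ | ⟨-, h'⟩ <;>
  · simp only [h, h', List.mem_cons, List.not_mem_nil, or_false] at hxp hxq
    grind

theorem exists_disjoint_paths_iff [Finite V] (huv : u ≠ v) :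
    (∃ P : Finset (G.Path u v), #P = t ∧ (∀ p ∈ P, p.1.length ≤ 2) ∧
      (P : Set (G.Path u v)).Pairwise InternallyDisjoint) ↔
    t ≤ {w | G.Adj u w ∧ (w = v ∨ G.Adj w v)}.ncard := by
  have hbij := getVert_one_bijOn (G := G) huv
  rw [← hbij.image_eq, hbij.injOn.ncard_image]
  have hfin : {p : G.Path u v | p.1.length ≤ 2}.Finite :=
    .of_injOn hbij.mapsTo hbij.injOn (Set.toFinite _)
  constructor
  · rintro ⟨P, rfl, hP, -⟩
    rw [← Set.ncard_coe_finset]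
    exact Set.ncard_le_ncard hP hfin
  · intro h
    rw [Set.ncard_eq_toFinset_card _ hfin] at h
    obtain ⟨P, hsub, hP⟩ := exists_subset_card_eq h
    have hlen : ∀ p ∈ P, p.1.length ≤ 2 := fun p hp => by simpa using hsub hp
    exact ⟨P, hP, hlen, fun p hp q hq => internallyDisjoint_of_ne huv (hlen p hp) (hlen q hq)⟩

theorem isRobust_iff :
    IsRobust t G S ↔ (S : Set V).Pairwise fun u v => ¬ IsRobustObstruction t G S u v := by
  have hcard (u v : (S : Set V)) : {w | (G.induce (S : Set V)).Adj u w ∧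
      (w = v ∨ (G.induce (S : Set V)).Adj w v)}.ncard = #(detours G S u v) := by
    rw [← Set.ncard_coe_finset, ← Set.ncard_image_of_injective _ Subtype.val_injective]
    congr 1
    refine Set.Subset.antisymm ?_ fun w hw => ?_
    · rintro - ⟨w, ⟨huw, hwv⟩, rfl⟩
      exact mem_detours.2 ⟨w.2, huw, hwv.imp_left (congrArg _)⟩
    · obtain ⟨hwS, huw, hwv⟩ := mem_detours.1 hw
      exact ⟨⟨w, hwS⟩, ⟨huw, hwv.imp_left Subtype.ext⟩, rfl⟩
  have hiff (u v : (S : Set V)) (huv : u ≠ v) := exists_disjoint_paths_iff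
    (G := G.induce (S : Set V)) (t := t) huv
  simp only [hcard] at hiff
  simp only [IsRobust, IsRobustObstruction, not_lt]
  refine ⟨fun h u hu v hv huv => ?_,
    fun h u v huv => (hiff u v huv).2 (h u.2 v.2 (Subtype.coe_ne_coe.2 huv))⟩
  have huv' : (⟨u, hu⟩ : (S : Set V)) ≠ ⟨v, hv⟩ := Subtype.coe_ne_coe.1 huv
  exact (hiff _ _ huv').1 (h _ _ huv')

end Obstructions

end TwoClub

namespace WordRAM

open Finset TwoClub

namespace Reg

@[simp] abbrev vertex : ℕ := 20
@[simp] abbrev common : ℕ := 21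
@[simp] abbrev detours : ℕ := 22

end Reg

section Tests

variable {B N n t k : ℕ} {G : SimpleGraph (Fin n)} {S : Finset (Fin n)} {u v : Fin n} {s : Store}
  {e f : Expr}

/-- The adjacency matrix is stored row by row. -/
def adj (e f : Expr) : Expr := .cell Arr.graph (e * Reg.size + f)

theorem Encodes.decides_adj (h : Encodes B N G t k s) (he : e.HasValue B s u)
    (hf : f.HasValue B s v) : (adj e f).Decides B s (G.Adj u v) := by
  classical
  exact ((he.index h.size hf (h.index_le (by omega) v)).cell (by convert h.graph u v)).decides

/-- Count the common neighbours of `Reg.fst` and `Reg.snd` in the set in array `Arr.set`. -/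
def countCommon : Prog :=
  .countLoop Reg.vertex Reg.size Reg.common
    (.cell Arr.set Reg.vertex * (adj Reg.fst Reg.vertex * adj Reg.vertex Reg.snd))

theorem wp_countCommon (hE : Encodes B N G t k s) (hS : HoldsSet Arr.set S s)
    (hu : s.reg Reg.fst = u) (hv : s.reg Reg.snd = v) :
    WP B N countCommon (fun s' => s'.reg Reg.common = #(common G S u v)) s := by
  classical
  refine (WP.countLoop (P := (· ∈ common G S u v)) hE.size hE.le_loops fun w s' hf hw => ?_).mono
    fun s' _ h => by simpa only [filter_univ_mem] using h
  have hE' := hE.frame hf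
  exact (((hS.frame hf).decides (.reg hw)).and
    ((hE'.decides_adj (.reg ((hf.reg _ rfl).trans hu)) (.reg hw)).and
      (hE'.decides_adj (.reg hw) (.reg ((hf.reg _ rfl).trans hv))))).congr mem_common.symm

/-- Test whether `Reg.fst` and `Reg.snd` form an obstruction to hereditary 2-clubs. -/
def hereditaryTest : Prog :=
  countCommon ;;
  .set Reg.answer ((adj Reg.fst Reg.snd =ₑ 0) * ((Reg.param <ₑ Reg.common) =ₑ 0))

theorem isTest_hereditaryTest :
    IsTest (fun _ G t => IsHereditaryObstruction t G) hereditaryTest where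
  reg := by decide
  arr := by decide
  decides {B} _ _ _ _ _ _ _ _ _ hE hS hu hv _ _ _ := by
    refine (wp_countCommon hE hS hu hv).bind fun s' hf hcard => ?_
    have hE' := hE.frame hf
    have hadj := hE'.decides_adj (.reg ((hf.reg _ rfl).trans hu)) (.reg ((hf.reg _ rfl).trans hv))
    have hlt := (Expr.HasValue.reg (B := B) hE'.param).lt (.reg hcard)
    exact (WP.assign (hadj.not.and hlt.not)).mono fun s'' _ h =>
      Expr.Decides.congr (.reg h) (and_congr_right' not_lt)

/-- Count the paths of length at most two from `Reg.fst` to `Reg.snd` in the set in array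
`Arr.set`. -/
def countDetours : Prog :=
  .countLoop Reg.vertex Reg.size Reg.detours (.cell Arr.set Reg.vertex *
    (adj Reg.fst Reg.vertex *
      (((Reg.vertex =ₑ Reg.snd) =ₑ 0) * (adj Reg.vertex Reg.snd =ₑ 0) =ₑ 0)))

theorem wp_countDetours (hE : Encodes B N G t k s) (hS : HoldsSet Arr.set S s)
    (hu : s.reg Reg.fst = u) (hv : s.reg Reg.snd = v) :
    WP B N countDetours (fun s' => s'.reg Reg.detours = #(detours G S u v)) s := by
  classical
  refine (WP.countLoop (P := (· ∈ detours G S u v)) hE.size hE.le_loops fun w s' hf hw => ?_).mono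
    fun s' _ h => by simpa only [filter_univ_mem] using h
  have hE' := hE.frame hf
  have hv' : s'.reg Reg.snd = v := (hf.reg _ rfl).trans hv
  have hwv := ((Expr.HasValue.reg (B := B) hw).eq (.reg hv')).not.and
    (hE'.decides_adj (.reg hw) (.reg hv')).not
  refine (((hS.frame hf).decides (.reg hw)).and
    ((hE'.decides_adj (.reg ((hf.reg _ rfl).trans hu)) (.reg hw)).and hwv.not)).congr ?_
  rw [mem_detours, ← not_or, not_not, Fin.val_inj]

/-- Test whether `Reg.fst` and `Reg.snd` form an obstruction to robust 2-clubs. -/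
def robustTest : Prog :=
  countDetours ;;
  .set Reg.answer (Reg.detours <ₑ Reg.param)

theorem isTest_robustTest : IsTest (fun _ G t => IsRobustObstruction t G) robustTest where
  reg := by decide
  arr := by decide
  decides hE hS hu hv _ _ _ := by
    refine (wp_countDetours hE hS hu hv).bind fun s' hf hcard => ?_
    exact (WP.assign ((Expr.HasValue.reg hcard).lt (.reg (hE.frame hf).param))).mono
      fun _ _ h => .reg h

theorem isSizeTest_not_lt :
    IsSizeTest (fun _ k m => k ≤ m) ((Reg.count <ₑ Reg.target) =ₑ 0) :=
  fun _ htarget hcount => ((Expr.HasValue.reg hcount).lt (.reg htarget)).not.congr not_lt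

theorem solvableInTimeO_hereditaryTwoClub :
    SolvableInTimeO HereditaryTwoClub fun n => 1.62 ^ n :=
  solvableInTimeO_of_isTest isTest_hereditaryTest isSizeTest_not_lt
    (fun _ _ _ _ _ => isHereditaryObstruction_antitone) (fun _ _ _ _ h => h.trans')
    fun _ _ _ _ => exists_congr fun _ => and_congr_left' isHereditary_iff

theorem solvableInTimeO_robustTwoClub : SolvableInTimeO RobustTwoClub fun n => 1.62 ^ n :=
  solvableInTimeO_of_isTest isTest_robustTest isSizeTest_not_lt
    (fun _ _ _ _ _ => isRobustObstruction_antitone) (fun _ _ _ _ h => h.trans')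
    fun _ _ _ _ => exists_congr fun _ => and_congr_left' isRobust_iff

end Tests

end WordRAM

namespace TwoClub

open Finset

/-! ### Cuts and residual networks -/

section Network

variable {V : Type*} [DecidableEq V] {R R' : V → V → ℕ} {src sink a b x y : V}

/-- The network that arises from `R` when one unit of capacity is moved from the arc from `a` to `b`
to the opposite arc. -/
def reverseArc (R : V → V → ℕ) (a b : V) : V → V → ℕ := fun x y =>
  R x y + (if x = b ∧ y = a then 1 else 0) - if x = a ∧ y = b then 1 else 0

theorem reverseArc_add (hR : 0 < R a b) (x y : V) :
    reverseArc R a b x y + (if x = a ∧ y = b then 1 else 0) =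
      R x y + if x = b ∧ y = a then 1 else 0 := by
  refine Nat.sub_add_cancel ?_
  split_ifs with hba hab <;> grind

theorem reverseArc_add_swap (hR : 0 < R a b) (x y : V) :
    reverseArc R a b x y + reverseArc R a b y x = R x y + R y x := by
  have hxy := reverseArc_add hR x y
  have hyx := reverseArc_add hR y x
  simp only [and_comm (a := y = _)] at hyx
  omega

variable [Fintype V]

/-- The capacity of the arcs of the network `R` that leave `X`. -/
def cut (R : V → V → ℕ) (X : Finset V) : ℕ := ∑ a ∈ X, ∑ b ∈ Xᶜ, R a b

theorem cut_map {W : Type*} [Fintype W] [DecidableEq W] (e : V ≃ W) (X : Finset V) :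
    cut (fun x y => R (e.symm x) (e.symm y)) (X.map e.toEmbedding) = cut R X := by
  have hcompl : (X.map e.toEmbedding)ᶜ = Xᶜ.map e.toEmbedding := by
    ext
    simp
  simp [cut, hcompl]

theorem cut_eq_zero_iff {X : Finset V} : cut R X = 0 ↔ ∀ a ∈ X, ∀ b ∉ X, R a b = 0 := by
  simp [cut, sum_eq_zero_iff]

theorem cut_reverseArc (hR : 0 < R a b) (X : Finset V) :
    cut (reverseArc R a b) X + (if a ∈ X then 1 else 0) = cut R X + if b ∈ X then 1 else 0 := by
  have hunit (c d : V) : (∑ x ∈ X, ∑ y ∈ Xᶜ, if x = c ∧ y = d then 1 else 0) =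
      if c ∈ X ∧ d ∉ X then 1 else 0 := by
    simp [ite_and]
  have hsum := sum_congr (rfl : X = X) fun x _ =>
    sum_congr (rfl : Xᶜ = Xᶜ) fun y _ => reverseArc_add hR x y
  simp only [sum_add_distrib, hunit] at hsum
  by_cases ha : a ∈ X <;> by_cases hb : b ∈ X <;> simp_all [cut]

/-- Some flow of value `q` from `src` to `sink` in the network `R` leaves the residual network
`R'`. Only the effect on the capacities of the cuts that separate `sink` from `src` is recorded. -/
def IsResidual (R R' : V → V → ℕ) (src sink : V) (q : ℕ) : Prop :=
  ∀ X : Finset V, src ∈ X → sink ∉ X → cut R' X + q = cut R X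

/-- The vertices with positive depth in a search tree. -/
def reached (dep : V → ℕ) : Finset V := {v | dep v ≠ 0}

theorem card_reached_update {dep : V → ℕ} {d : ℕ} (hb : dep b = 0) (hd : d ≠ 0) :
    #(reached (Function.update dep b d)) = #(reached dep) + 1 := by
  have hinsert : reached (Function.update dep b d) = insert b (reached dep) := by
    ext v
    rcases eq_or_ne v b with rfl | hv <;> simp [reached, *]
  rw [hinsert, card_insert_of_notMem (by simp [reached, hb])]

/-- The depths `dep` and the parents `par` describe a tree with root `src` whose arcs have positive
capacity in `R`. The depth of `src` is `1`, and the vertices outside the tree have depth `0`. -/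
structure IsSearchTree (R : V → V → ℕ) (src : V) (dep : V → ℕ) (par : V → V) : Prop where
  dep_src : dep src = 1
  dep_le : ∀ b, dep b ≤ #(reached dep)
  arc : ∀ b, dep b ≠ 0 → b ≠ src → dep (par b) ≠ 0 ∧ dep b = dep (par b) + 1 ∧ 0 < R (par b) b

variable {dep : V → ℕ} {par : V → V}

theorem isSearchTree_single : IsSearchTree R src (Function.update (fun _ => 0) src 1) par where
  dep_src := by simp
  dep_le b := by
    rw [card_reached_update (dep := fun _ => 0) rfl one_ne_zero]
    rcases eq_or_ne b src with rfl | hb <;> simp [*]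
  arc b hb hsrc := absurd (Function.update_of_ne hsrc _ _) hb

theorem IsSearchTree.insert (h : IsSearchTree R src dep par) (ha : dep a ≠ 0) (hb : dep b = 0)
    (hR : 0 < R a b) :
    IsSearchTree R src (Function.update dep b (dep a + 1)) (Function.update par b a) := by
  have hne {c : V} (hc : dep c ≠ 0) : c ≠ b := fun hcb => hc (hcb ▸ hb)
  refine ⟨?_, fun c => ?_, fun c hc hsrc => ?_⟩
  · rw [Function.update_of_ne (hne (by simp [h.dep_src])), h.dep_src]
  · rw [card_reached_update hb (by omega)]
    have ha' := h.dep_le a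
    have hc' := h.dep_le c
    rcases eq_or_ne c b with rfl | hcb
    · simpa using ha'
    · rw [Function.update_of_ne hcb]
      omega
  · rcases eq_or_ne c b with rfl | hcb
    · simpa [hne ha, ha] using hR
    · rw [Function.update_of_ne hcb] at hc
      obtain ⟨hpar, hdep, hcap⟩ := h.arc c hc hsrc
      simpa [hcb, hne hpar] using ⟨hpar, hdep, hcap⟩

/-- The network `R'` arises from `R` by the reversal of the path in the search tree from `x` to
`sink`. -/
structure IsReversedFrom (R R' : V → V → ℕ) (dep : V → ℕ) (sink x : V) : Prop where
  cut_add : ∀ X, cut R' X + (if x ∈ X then 1 else 0) = cut R X + if sink ∈ X then 1 else 0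
  eq : ∀ a b, dep a ≤ dep x → dep b ≤ dep x → R' a b = R a b

theorem IsReversedFrom.pos (h : IsReversedFrom R R' dep sink x) (ht : IsSearchTree R src dep par)
    (hx : dep x ≠ 0) (hsrc : x ≠ src) : 0 < R' (par x) x := by
  obtain ⟨-, hdep, hR⟩ := ht.arc x hx hsrc
  rwa [h.eq _ _ (by omega) le_rfl]

theorem IsReversedFrom.step (h : IsReversedFrom R R' dep sink x)
    (ht : IsSearchTree R src dep par) (hx : dep x ≠ 0) (hsrc : x ≠ src) :
    IsReversedFrom R (reverseArc R' (par x) x) dep sink (par x) := by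
  obtain ⟨-, hdep, -⟩ := ht.arc x hx hsrc
  refine ⟨fun X => (cut_reverseArc (h.pos ht hx hsrc) X).trans (h.cut_add X), fun a b ha hb => ?_⟩
  have hax : a ≠ x := fun hax => by rw [hax] at ha; omega
  have hbx : b ≠ x := fun hbx => by rw [hbx] at hb; omega
  simpa [reverseArc, hax, hbx] using h.eq a b (by omega) (by omega)

theorem IsResidual.reverse {R'' : V → V → ℕ} {q : ℕ} (h : IsResidual R R' src sink q)
    (hrev : IsReversedFrom R' R'' dep sink src) : IsResidual R R'' src sink (q + 1) := by
  intro X hsrc hsink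
  have := h X hsrc hsink
  have := hrev.cut_add X
  simp only [hsrc, hsink, if_true, if_false] at this
  omega

end Network

end TwoClub

namespace WordRAM

open Finset TwoClub

/-! ### Maximum flow -/

namespace Reg

@[simp] abbrev nodes : ℕ := 30
@[simp] abbrev source : ℕ := 31
@[simp] abbrev sink : ℕ := 32
@[simp] abbrev flow : ℕ := 33
@[simp] abbrev phase : ℕ := 34
@[simp] abbrev round : ℕ := 35
@[simp] abbrev tail : ℕ := 36
@[simp] abbrev head : ℕ := 37

end Reg

namespace Arr

@[simp] abbrev residual : ℕ := 3
@[simp] abbrev depth : ℕ := 4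
@[simp] abbrev parent : ℕ := 5

end Arr

section Flow

/-- The memory `s` contains the network `R`, whose capacities fit into a machine word even if the
capacities of two opposite arcs are united. -/
structure HoldsNetwork {m : ℕ} (B N : ℕ) (R : Fin m → Fin m → ℕ) (src sink : Fin m) (s : Store) :
    Prop where
  word : m * (m + 1) ≤ B
  loops : m ≤ N
  capacity : ∀ x y, R x y + R y x ≤ B
  nodes : s.reg Reg.nodes = m
  source : s.reg Reg.source = src
  sink : s.reg Reg.sink = sink
  residual : HoldsMatrix Arr.residual R s

/-- The memory `s` contains the depths `dep` and the parents `par` of a search tree. -/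
structure HoldsTree {m : ℕ} (dep : Fin m → ℕ) (par : Fin m → Fin m) (s : Store) : Prop where
  depth : HoldsRow Arr.depth 0 dep s
  parent : HoldsRow Arr.parent 0 (fun v => par v) s

variable {B N m : ℕ} {R : Fin m → Fin m → ℕ} {src sink a b : Fin m} {s s' : Store} {p : Prog}
  {dep : Fin m → ℕ} {par : Fin m → Fin m} {e f : Expr}

theorem HoldsNetwork.frame (h : HoldsNetwork B N R src sink s) (hf : Frame p s s')
    (hnodes : p.writesReg Reg.nodes = false := by rfl)
    (hsource : p.writesReg Reg.source = false := by rfl)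
    (hsink : p.writesReg Reg.sink = false := by rfl)
    (hresidual : p.writesArr Arr.residual = false := by rfl) : HoldsNetwork B N R src sink s' where
  word := h.word
  loops := h.loops
  capacity := h.capacity
  nodes := (hf.reg _ hnodes).trans h.nodes
  source := (hf.reg _ hsource).trans h.source
  sink := (hf.reg _ hsink).trans h.sink
  residual := by simpa only [HoldsMatrix, HoldsRow, hf.arr _ hresidual] using h.residual

theorem HoldsTree.frame (h : HoldsTree dep par s) (hf : Frame p s s')
    (hdepth : p.writesArr Arr.depth = false := by rfl)
    (hparent : p.writesArr Arr.parent = false := by rfl) : HoldsTree dep par s' where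
  depth := by simpa only [HoldsRow, hf.arr _ hdepth] using h.depth
  parent := by simpa only [HoldsRow, hf.arr _ hparent] using h.parent

theorem HoldsTree.hasValue_depth (h : HoldsTree dep par s) (he : e.HasValue B s a) :
    (Expr.cell Arr.depth e).HasValue B s (dep a) :=
  he.cell (by simpa using h.depth a)

theorem HoldsTree.hasValue_parent (h : HoldsTree dep par s) (he : e.HasValue B s a) :
    (Expr.cell Arr.parent e).HasValue B s (par a) :=
  he.cell (by simpa using h.parent a)

/-- The position of the arc from `e` to `f` in array `Arr.residual`. -/
def arcIndex (e f : Expr) : Expr := e * Reg.nodes + f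

theorem HoldsNetwork.hasValue_arcIndex (h : HoldsNetwork B N R src sink s) (he : e.HasValue B s a)
    (hf : f.HasValue B s b) : (arcIndex e f).HasValue B s (a * m + b) := by
  refine he.index h.nodes hf (le_trans ?_ h.word)
  nlinarith [a.isLt, b.isLt]

theorem HoldsNetwork.hasValue_capacity (h : HoldsNetwork B N R src sink s) (he : e.HasValue B s a)
    (hf : f.HasValue B s b) : (Expr.cell Arr.residual (arcIndex e f)).HasValue B s (R a b) :=
  (h.hasValue_arcIndex he hf).cell (h.residual a b)

/-! ### Search for an augmenting path -/

/-- Build the search tree that consists of the source only. -/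
def initTree : Prog :=
  .forLoop Reg.head Reg.nodes (.store Arr.depth Reg.head 0) ;;
  .forLoop Reg.head Reg.nodes (.store Arr.parent Reg.head Reg.source) ;;
  .store Arr.depth Reg.source 1

theorem wp_initTree (h : HoldsNetwork B N R src sink s) :
    WP B N initTree (HoldsTree (Function.update (fun _ => 0) src 1) fun _ => src) s := by
  refine (WP.fillRow (r := 0) (f := fun _ => 0) h.nodes h.loops
    (fun j s' _ hj => .reg (by simpa using hj)) fun _ _ _ _ _ => .zero).bind fun s₁ hf₁ h₁ => ?_
  have hN₁ := h.frame hf₁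
  refine (WP.fillRow (r := 0) (f := fun _ => src) hN₁.nodes hN₁.loops
    (fun j s' _ hj => .reg (by simpa using hj))
    fun _ s' hf _ _ => .reg (hN₁.frame hf).source).bind fun s₂ hf₂ h₂ => ?_
  refine (WP.write (.reg (hN₁.frame hf₂).source) .one).mono fun s₃ hf₃ h₃ => ⟨?_, ?_⟩
  · refine HoldsRow.update (s := s₂) (fun j => ?_) (by simpa using h₃)
    rw [hf₂.arr _ rfl, h₁.1 j]
  · intro j
    rw [hf₃.arr _ rfl, h₂.1 j]

/-- One round of the search: each arc that leaves the tree with positive capacity is added to it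
when
it is examined. -/
def growTree : Prog :=
  .forPairs Reg.tail Reg.head Reg.nodes
    (.cond ((0 <ₑ .cell Arr.depth Reg.tail) *
        ((0 <ₑ .cell Arr.residual (arcIndex Reg.tail Reg.head)) * (.cell Arr.depth Reg.head =ₑ 0)))
      (.store Arr.depth Reg.head (.cell Arr.depth Reg.tail + 1) ;;
        .store Arr.parent Reg.head Reg.tail)
      .skip)

/-- The state of the search when every round has added a vertex to the tree, unless no arc leaves
the tree any more. In the current round, the arcs in `D` have been examined. -/
def Searching (R : Fin m → Fin m → ℕ) (src : Fin m) (r : ℕ) (D : Finset (Fin m × Fin m))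
    (s : Store) : Prop :=
  ∃ dep par, HoldsTree dep par s ∧ IsSearchTree R src dep par ∧
    (cut R (reached dep) = 0 ∨ r < #(reached dep)) ∧
    ((∀ x ∈ D, ¬ (dep x.1 ≠ 0 ∧ 0 < R x.1 x.2 ∧ dep x.2 = 0)) ∨ r + 1 < #(reached dep))

theorem Searching.setReg {r i v : ℕ} {D : Finset (Fin m × Fin m)} (h : Searching R src r D s) :
    Searching R src r D (s.setReg i v) := by
  obtain ⟨dep, par, hT, h⟩ := h
  exact ⟨dep, par, hT.frame (.setReg (e := 0)), h⟩

theorem wp_addArc (hN : HoldsNetwork B N R src sink s) (h : HoldsTree dep par s)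
    (ht : IsSearchTree R src dep par)
    (ha : s.reg Reg.tail = a) (hb : s.reg Reg.head = b) :
    WP B N (.store Arr.depth Reg.head (.cell Arr.depth Reg.tail + 1) ;;
        .store Arr.parent Reg.head Reg.tail)
      (HoldsTree (Function.update dep b (dep a + 1)) (Function.update par b a)) s := by
  have hle : dep a + 1 ≤ B := by
    have := (ht.dep_le a).trans (card_le_univ _)
    rw [Fintype.card_fin] at this
    nlinarith [hN.word, a.pos]
  refine (WP.write (.reg hb) ((h.hasValue_depth (.reg ha)).add .one hle)).bind fun s₁ hf₁ h₁ => ?_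
  refine (WP.write (.reg ((hf₁.reg _ rfl).trans hb)) (.reg ((hf₁.reg _ rfl).trans ha))).mono
    fun s₂ hf₂ h₂ => ⟨?_, ?_⟩
  · have := h.depth.update (s' := s₁) (by simpa using h₁)
    simpa only [HoldsRow, hf₂.arr Arr.depth rfl] using this
  · rw [hf₁.arr _ rfl] at h₂
    have := h.parent.update (s' := s₂) (by simpa using h₂)
    simpa only [Function.apply_update fun _ (v : Fin m) => (v : ℕ)] using this

theorem wp_growTree {r : ℕ} (h : HoldsNetwork B N R src sink s) (hS : Searching R src r ∅ s) :
    WP B N growTree (Searching R src (r + 1) ∅) s := by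
  refine (WP.forPairs (n := m) (Searching R src r) h.nodes h.loops hS
    (fun D x s' hf hx₁ hx₂ hI => ?_)
    (fun _ _ _ h => ⟨h.setReg, h.setReg⟩)).mono fun s' _ hS' => ?_
  · obtain ⟨dep, par, hT, ht, hr, hD⟩ := hI
    have hN := h.frame hf
    refine WP.cond (((Expr.HasValue.zero.lt (hT.hasValue_depth (.reg hx₁))).and
      ((Expr.HasValue.zero.lt (hN.hasValue_capacity (.reg hx₁) (.reg hx₂))).and
        ((hT.hasValue_depth (.reg hx₂)).eq .zero))))
      (fun ⟨ha, hR, hb⟩ => ?_) fun hx => WP.skip ⟨dep, par, hT, ht, hr, ?_⟩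
    · refine (wp_addArc hN hT ht hx₁ hx₂).mono fun s'' _ hT' =>
        ⟨_, _, hT', ht.insert ha.ne' hb hR, ?_⟩
      have hcut : cut R (reached dep) ≠ 0 := fun hcut =>
        hR.ne' (cut_eq_zero_iff.1 hcut _ (by simpa [reached] using ha.ne') _
          (by simpa [reached] using hb))
      rw [card_reached_update hb (by omega)]
      omega
    · refine hD.imp_left fun hD y hy => ?_
      rcases mem_insert.1 hy with rfl | hy
      · simpa only [Nat.pos_iff_ne_zero] using hx
      · exact hD y hy
  · obtain ⟨dep, par, hT, ht, -, hD⟩ := hS'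
    refine ⟨dep, par, hT, ht, hD.imp_left fun hD => cut_eq_zero_iff.2 fun a ha b hb => ?_, by simp⟩
    have := hD (a, b) (mem_univ _)
    simp only [reached, mem_filter, mem_univ, true_and, not_not] at ha hb
    grind

/-- Build a search tree that no arc of positive capacity leaves. -/
def searchPath : Prog :=
  initTree ;; .forLoop Reg.round Reg.nodes growTree

theorem wp_searchPath (h : HoldsNetwork B N R src sink s) :
    WP B N searchPath (fun s' => ∃ dep par, HoldsTree dep par s' ∧ IsSearchTree R src dep par ∧
      cut R (reached dep) = 0) s := by
  refine (wp_initTree h).bind fun s₁ hf₁ hT => ?_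
  have hN₁ := h.frame hf₁
  refine (WP.forLoop (fun r => Searching R src r ∅) hN₁.nodes hN₁.loops
    ⟨_, _, hT, isSearchTree_single, .inr ?_, by simp⟩
    (fun j s' hf _ hI => wp_growTree (hN₁.frame hf) hI)
    fun _ _ _ h => h.setReg).mono fun s₂ _ ⟨dep, par, hT₂, ht, hcut, _⟩ =>
      ⟨dep, par, hT₂, ht, hcut.resolve_right ?_⟩
  · rw [card_reached_update (dep := fun _ => 0) rfl one_ne_zero]
    exact Nat.succ_pos _
  · simpa using card_le_univ (reached dep)

/-! ### Augmentation of the flow -/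

/-- Move one unit of capacity from the arc from `Reg.tail` to `Reg.head` to the opposite arc. -/
def moveUnit : Prog :=
  .store Arr.residual (arcIndex Reg.tail Reg.head)
      (.cell Arr.residual (arcIndex Reg.tail Reg.head) - 1) ;;
    .store Arr.residual (arcIndex Reg.head Reg.tail)
      (.cell Arr.residual (arcIndex Reg.head Reg.tail) + 1)

theorem wp_moveUnit (h : HoldsNetwork B N R src sink s) (hab : a ≠ b) (hR : 0 < R a b)
    (ha : s.reg Reg.tail = a) (hb : s.reg Reg.head = b) :
    WP B N moveUnit (HoldsNetwork B N (reverseArc R a b) src sink) s := by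
  have hcap := h.capacity a b
  refine (WP.write (h.hasValue_arcIndex (.reg ha) (.reg hb))
    ((h.hasValue_capacity (.reg ha) (.reg hb)).sub .one)).bind fun s₁ hf₁ h₁ => ?_
  have ha₁ := (hf₁.reg Reg.tail rfl).trans ha
  have hb₁ := (hf₁.reg Reg.head rfl).trans hb
  have hres₁ := h.residual.update h₁
  have hN₁ : HoldsNetwork B N _ src sink s₁ :=
    ⟨h.word, h.loops, fun x y => (add_le_add ?_ ?_).trans (h.capacity x y),
      (hf₁.reg _ rfl).trans h.nodes, (hf₁.reg _ rfl).trans h.source, (hf₁.reg _ rfl).trans h.sink,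
      hres₁⟩
  · refine (WP.write (hN₁.hasValue_arcIndex (.reg hb₁) (.reg ha₁))
      ((hN₁.hasValue_capacity (.reg hb₁) (.reg ha₁)).add .one ?_)).mono fun s₂ hf₂ h₂ =>
      ⟨h.word, h.loops, fun x y => (reverseArc_add_swap hR x y).trans_le (h.capacity x y),
        (hf₂.reg _ rfl).trans hN₁.nodes, (hf₂.reg _ rfl).trans hN₁.source,
        (hf₂.reg _ rfl).trans hN₁.sink, ?_⟩
    · simp [hab.symm]
      omega
    · convert hres₁.update h₂ using 1
      ext x y
      simp only [reverseArc, Function.update_apply]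
      grind
  · simp only [Function.update_apply]
    grind
  · simp only [Function.update_apply]
    grind

/-- Reverse the arcs of the search tree on the path from the source to the sink, starting at the
sink. -/
def reversePath : Prog :=
  .set Reg.head Reg.sink ;;
    .loop ((Reg.head =ₑ Reg.source) =ₑ 0)
      (.set Reg.tail (.cell Arr.parent Reg.head) ;; moveUnit ;; .set Reg.head Reg.tail)

theorem wp_reversePath (h : HoldsNetwork B N R src sink s) (hT : HoldsTree dep par s)
    (ht : IsSearchTree R src dep par) (hsink : dep sink ≠ 0) :
    WP B N reversePath (fun s' => ∃ R', HoldsNetwork B N R' src sink s' ∧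
      IsReversedFrom R R' dep sink src) s := by
  let J (d : ℕ) (s' : Store) : Prop := ∃ R' x, HoldsNetwork B N R' src sink s' ∧
    s'.reg Reg.head = (x : Fin m) ∧ dep x = d + 1 ∧ IsReversedFrom R R' dep sink x
  have hroot {x : Fin m} {d : ℕ} (hx : dep x = d + 1) : x = src ↔ d = 0 := by
    refine ⟨fun hsrc => by simpa [hsrc, ht.dep_src] using hx.symm, fun hd => ?_⟩
    by_contra hsrc
    have := ht.arc x (by omega) hsrc
    omega
  have hlen : dep sink - 1 ≤ N := by
    have := (ht.dep_le sink).trans (card_le_univ _)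
    rw [Fintype.card_fin] at this
    have := h.loops
    omega
  refine (WP.assign (.reg h.sink)).bind fun s₁ hf₁ hhead => ?_
  refine (WP.loop J hlen ⟨R, sink, h.frame hf₁, hhead, by omega, fun _ => rfl, fun _ _ _ _ => rfl⟩
    ?_ ?_).mono fun s₂ _ ⟨R', x, hN, _, hx, hrev⟩ => ⟨R', hN, (hroot hx).2 rfl ▸ hrev⟩
  · rintro d s' - ⟨R', x, hN, hhead, hx, -⟩
    refine ((Expr.HasValue.reg hhead).eq (.reg hN.source)).not.congr ?_
    rw [Ne, ← hroot hx, Fin.ext_iff]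
  · rintro d s' hf ⟨R', x, hN, hhead, hx, hrev⟩
    have hx₀ : dep x ≠ 0 := by omega
    have hsrc : x ≠ src := by simp [hroot hx]
    obtain ⟨-, hdep, -⟩ := ht.arc x hx₀ hsrc
    refine (WP.assign (((hT.frame hf₁).frame hf).hasValue_parent (.reg hhead))).bind
      fun s₂ hf₂ htail => ?_
    refine (wp_moveUnit (hN.frame hf₂) (fun hp => by rw [hp] at hdep; omega)
      (hrev.pos ht hx₀ hsrc) htail ((hf₂.reg _ rfl).trans hhead)).bind fun s₃ hf₃ hN₃ => ?_
    refine (WP.assign (.reg ((hf₃.reg _ rfl).trans htail))).mono fun s₄ hf₄ hhead₄ =>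
      ⟨_, par x, hN₃.frame hf₄, hhead₄, by omega, hrev.step ht hx₀ hsrc⟩

/-- The state after `i` attempts to augment the flow: unless all of them were successful, the
residual network shows that the flow is maximum. -/
def Augmenting (B N : ℕ) (R : Fin m → Fin m → ℕ) (src sink : Fin m) (i : ℕ) (s : Store) : Prop :=
  ∃ R', HoldsNetwork B N R' src sink s ∧ IsResidual R R' src sink (s.reg Reg.flow) ∧
    s.reg Reg.flow ≤ i ∧ (s.reg Reg.flow = i ∨ ∃ X, src ∈ X ∧ sink ∉ X ∧ cut R' X = 0)

/-- Augment the flow by one unit along the search tree if the tree contains the sink. -/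
def augmentFlow : Prog :=
  searchPath ;; .cond (0 <ₑ .cell Arr.depth Reg.sink)
    (reversePath ;; .set Reg.flow (Reg.flow + 1)) .skip

theorem wp_augmentFlow {i : ℕ} (hi : i < m) (h : Augmenting B N R src sink i s) :
    WP B N augmentFlow (Augmenting B N R src sink (i + 1)) s := by
  obtain ⟨R', hN, hres, hle, hmax⟩ := h
  refine (wp_searchPath hN).bind fun s₁ hf₁ ⟨dep, par, hT, ht, hcut⟩ => ?_
  have hN₁ := hN.frame hf₁
  have hflow₁ : s₁.reg Reg.flow = s.reg Reg.flow := hf₁.reg _ rfl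
  refine WP.cond (Expr.HasValue.zero.lt (hT.hasValue_depth (.reg hN₁.sink)))
    (fun hsink => ?_) fun hsink => WP.skip ⟨R', hN₁, ?_⟩
  · refine (wp_reversePath hN₁ hT ht hsink.ne').bind fun s₂ hf₂ ⟨R'', hN₂, hrev⟩ => ?_
    have hflow₂ := (hf₂.reg _ rfl).trans hflow₁
    refine (WP.assign ((Expr.HasValue.reg hflow₂).add .one ?_)).mono fun s₃ hf₃ hflow₃ => ?_
    · nlinarith [hN.word]
    · refine ⟨R'', hN₂.frame hf₃, hflow₃ ▸ hres.reverse hrev, by omega, hmax.imp (by omega) ?_⟩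
      rintro ⟨X, hsrc, hsink', hX⟩
      have := hrev.cut_add X
      simp only [hsrc, hsink', hX, if_true, if_false] at this
      omega
  · rw [hflow₁]
    exact ⟨hres, by omega, .inr ⟨reached dep, by simp [reached, ht.dep_src],
      by simpa [reached] using hsink, hcut⟩⟩

/-- Ford–Fulkerson with at most `Reg.nodes` augmentations. -/
def maxFlow : Prog :=
  .set Reg.flow 0 ;; .forLoop Reg.phase Reg.nodes augmentFlow

/-- As the computation stops after `m` augmentations, the flow need not be maximum if its value
is `m`. -/
theorem wp_maxFlow (h : HoldsNetwork B N R src sink s) :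
    WP B N maxFlow (fun s' => (∀ X, src ∈ X → sink ∉ X → s'.reg Reg.flow ≤ cut R X) ∧
      (s'.reg Reg.flow = m ∨ ∃ X, src ∈ X ∧ sink ∉ X ∧ cut R X = s'.reg Reg.flow)) s := by
  refine (WP.assign .zero).bind fun s₁ hf₁ h₁ => ?_
  refine (WP.forLoop (Augmenting B N R src sink) (h.frame hf₁).nodes h.loops
    ⟨R, h.frame hf₁, by simp [h₁, IsResidual], by simp [h₁]⟩
    (fun j s' _ _ hI => wp_augmentFlow j.isLt hI)
    fun _ _ _ ⟨R', hN, hres⟩ => ⟨R', hN.frame (.setReg (e := 0)), by exact hres⟩).mono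
    fun s₂ _ ⟨R', _, hres, _, hmax⟩ =>
      ⟨fun X hsrc hsink => by have := hres X hsrc hsink; omega,
        hmax.imp_right fun ⟨X, hsrc, hsink, hX⟩ => ⟨X, hsrc, hsink, ?_⟩⟩
  have := hres X hsrc hsink
  omega

end Flow

end WordRAM

namespace TwoClub

open Finset

/-! ### Separators -/

section Separators

variable {V : Type*} {G : SimpleGraph V} {t : ℕ} {S U : Finset V} {u v : V}

/-- The deletion of the vertices in `U` separates `v` from `u` in `G[S]`: the set `Y` is a union of
components of `G[S \ U]` with `u` but without `v`. -/
def IsSeparator (G : SimpleGraph V) (S U : Finset V) (u v : V) : Prop :=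
  u ∉ U ∧ v ∉ U ∧ ∃ Y : Set V, u ∈ Y ∧ v ∉ Y ∧ ∀ a ∈ Y, ∀ b ∈ S, b ∉ U → G.Adj a b → b ∈ Y

/-- In `G[S]`, the distance of `u` and `v` exceeds two, or fewer than `t` vertices separate them. -/
def IsConnectedObstruction (t : ℕ) (G : SimpleGraph V) (S : Finset V) (u v : V) : Prop :=
  ¬ G.Adj u v ∧ (common G S u v = ∅ ∨ ∃ U ⊆ S, #U < t ∧ IsSeparator G S U u v)

theorem isConnectedObstruction_antitone : Antitone fun S => IsConnectedObstruction t G S u v := by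
  classical
  refine fun S S' h => And.imp_right (Or.imp (fun hS' => ?_) ?_)
  · exact subset_empty.1 (hS' ▸ common_mono h)
  · rintro ⟨U, -, hcard, hu, hv, Y, huY, hvY, hY⟩
    refine ⟨U ∩ S, inter_subset_right, (card_le_card inter_subset_left).trans_lt hcard,
      fun hu' => hu (mem_of_mem_inter_left hu'), fun hv' => hv (mem_of_mem_inter_left hv'),
      Y, huY, hvY, fun a ha b hb hbU => ?_⟩
    exact hY a ha b (h hb) fun hbU' => hbU (mem_inter.2 ⟨hbU', hb⟩)

theorem isSeparator_iff_not_reachable (hu : u ∈ (S : Set V) \ U) (hv : v ∈ (S : Set V) \ U) :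
    IsSeparator G S U u v ↔ ¬ (G.induce ((S : Set V) \ U)).Reachable ⟨u, hu⟩ ⟨v, hv⟩ := by
  constructor
  · rintro ⟨-, -, Y, huY, hvY, hY⟩ ⟨p⟩
    refine hvY (p.rec (motive := fun a b _ => a.1 ∈ Y → b.1 ∈ Y) id ?_ huY)
    exact fun {a b c} hab _ ih ha => ih (hY a ha b b.2.1 b.2.2 hab)
  · refine fun h => ⟨hu.2, hv.2, {w | ∃ hw, (G.induce _).Reachable ⟨u, hu⟩ ⟨w, hw⟩}, ⟨hu, .rfl⟩,
      fun ⟨_, hw⟩ => h hw, ?_⟩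
    rintro a ⟨ha, hua⟩ b hbS hbU hab
    exact ⟨⟨hbS, hbU⟩, hua.trans (SimpleGraph.Adj.reachable (by exact hab))⟩

theorem connected_iff_pairwise_not_isSeparator (hcard : #U < #S) :
    (G.induce ((S : Set V) \ U)).Connected ↔
      (S : Set V).Pairwise fun u v => ¬ (¬ G.Adj u v ∧ IsSeparator G S U u v) := by
  constructor
  · rintro h u hu v hv - ⟨-, hsep⟩
    exact (isSeparator_iff_not_reachable ⟨hu, hsep.1⟩ ⟨hv, hsep.2.1⟩).1 hsep (h.preconnected _ _)
  · intro h
    obtain ⟨w, hw⟩ := exists_mem_notMem_of_card_lt_card hcard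
    have : Nonempty ↥((S : Set V) \ (U : Set V)) := ⟨⟨w, hw⟩⟩
    refine ⟨fun ⟨u, hu⟩ ⟨v, hv⟩ => ?_⟩
    by_contra hreach
    have hadj : ¬ G.Adj u v := fun hadj => hreach (SimpleGraph.Adj.reachable (by exact hadj))
    refine h hu.1 hv.1 ?_ ⟨hadj, (isSeparator_iff_not_reachable hu hv).2 hreach⟩
    rintro rfl
    exact hreach .rfl

theorem isConnected_iff : IsConnected t G S ↔
    (S : Set V).Pairwise (fun u v => ¬ IsConnectedObstruction t G S u v) ∧ t < #S := by
  have htwo : IsTwoClub G (S : Set V) ↔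
      (S : Set V).Pairwise fun u v => ¬ (¬ G.Adj u v ∧ common G S u v = ∅) := by
    simp only [isTwoClub_iff, Set.Pairwise, not_and, eq_empty_iff_forall_notMem, mem_common,
      mem_coe]
    push Not
    rfl
  constructor
  · rintro ⟨hclub, ht, hconn⟩
    refine ⟨fun u hu v hv huv ⟨hadj, hobs⟩ => ?_, ht⟩
    rcases hobs with hempty | ⟨U, hU, hUt, hsep⟩
    · exact htwo.1 hclub hu hv huv ⟨hadj, hempty⟩
    · exact (connected_iff_pairwise_not_isSeparator (hUt.trans ht)).1 (hconn U hU hUt) hu hv huv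
        ⟨hadj, hsep⟩
  · rintro ⟨h, ht⟩
    refine ⟨htwo.2 fun u hu v hv huv hobs => h hu hv huv ⟨hobs.1, .inl hobs.2⟩, ht,
      fun U hU hUt => (connected_iff_pairwise_not_isSeparator (hUt.trans ht)).2
        fun u hu v hv huv hobs => h hu hv huv ⟨hobs.1, .inr ⟨U, hU, hUt, hobs.2⟩⟩⟩

end Separators

/-! ### Separators as cuts of a network -/

section SplitNetwork

variable {V : Type*} [Fintype V] [DecidableEq V] {G : SimpleGraph V} {t q : ℕ} {S U : Finset V}
  {u v : V}

open scoped Classical in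
/-- The network for the vertex separators in `G[S]`: a vertex `w` is split into its entry `inl w`
and its exit `inr w`. The capacity of an edge exceeds the size of the separators that matter. -/
noncomputable def splitNetwork (G : SimpleGraph V) (S : Finset V) : V ⊕ V → V ⊕ V → ℕ
  | .inl w, .inr x => if w = x ∧ w ∈ S then 1 else 0
  | .inr w, .inl x => if G.Adj w x then Fintype.card V else 0
  | _, _ => 0

theorem splitNetwork_add_swap_le (a b : V ⊕ V) :
    splitNetwork G S a b + splitNetwork G S b a ≤ Fintype.card V + 1 := by
  rcases a with a | a <;> rcases b with b | b <;> simp only [splitNetwork] <;>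
    (try split_ifs) <;> omega

open scoped Classical in
theorem cut_splitNetwork (X : Finset (V ⊕ V)) :
    cut (splitNetwork G S) X = #{w ∈ S | .inl w ∈ X ∧ .inr w ∉ X} +
      #{x : V × V | .inr x.1 ∈ X ∧ .inl x.2 ∉ X ∧ G.Adj x.1 x.2} * Fintype.card V := by
  have hcut : cut (splitNetwork G S) X =
      ∑ a, ∑ b, if a ∈ X ∧ b ∉ X then splitNetwork G S a b else 0 := by
    simp only [cut, ite_and, ← mem_compl, sum_ite_irrel, sum_ite_mem, univ_inter, sum_const_zero]
  have hvertex (w x : V) : (if .inl w ∈ X ∧ .inr x ∉ X then splitNetwork G S (.inl w) (.inr x)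
      else 0) = if x = w then if w ∈ S ∧ .inl w ∈ X ∧ .inr w ∉ X then 1 else 0 else 0 := by
    simp only [splitNetwork]
    grind
  have hedge (w x : V) : (if .inr w ∈ X ∧ .inl x ∉ X then splitNetwork G S (.inr w) (.inl x)
      else 0) = if .inr w ∈ X ∧ .inl x ∉ X ∧ G.Adj w x then Fintype.card V else 0 := by
    simp only [splitNetwork]
    grind
  have hzero : ∑ w : V, ∑ x : V, (if .inl w ∈ X ∧ .inl x ∉ X then
      splitNetwork G S (.inl w) (.inl x) else 0) = 0 := by
    simp [splitNetwork]
  have hzero' : ∑ w : V, ∑ x : V, (if .inr w ∈ X ∧ .inr x ∉ X then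
      splitNetwork G S (.inr w) (.inr x) else 0) = 0 := by
    simp [splitNetwork]
  have hedges : ∑ w, ∑ x, (if .inr w ∈ X ∧ .inl x ∉ X ∧ G.Adj w x then Fintype.card V else 0) =
      #{x : V × V | .inr x.1 ∈ X ∧ .inl x.2 ∉ X ∧ G.Adj x.1 x.2} * Fintype.card V := by
    rw [← Fintype.sum_prod_type', ← sum_filter, sum_const, smul_eq_mul]
  simp only [hcut, Fintype.sum_sum_type, sum_add_distrib, hzero, hzero', hvertex, hedge, hedges,
    sum_ite_eq', mem_univ, if_true, zero_add, add_zero]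
  rw [add_comm, ← card_filter, ← filter_filter, filter_univ_mem]

theorem IsSeparator.exists_cut_le (h : IsSeparator G S U u v) (hv : v ∈ S) :
    ∃ X, .inr u ∈ X ∧ .inl v ∉ X ∧ cut (splitNetwork G S) X ≤ #U := by
  classical
  obtain ⟨-, hvU, Y, hu, hvY, hY⟩ := h
  refine ⟨univ.filter (Sum.elim (fun w => w ∈ Y ∨ w ∈ U ∨ w ∉ S) fun w => w ∈ Y), by simpa using hu,
    by simp [*], ?_⟩
  rw [cut_splitNetwork, add_comm, card_eq_zero.2 (filter_eq_empty_iff.2 fun x _ => ?_), zero_mul,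
    zero_add]
  · refine card_le_card fun w hw => ?_
    simp only [mem_filter, mem_univ, true_and, Sum.elim_inl, Sum.elim_inr] at hw
    tauto
  · have := hY x.1
    simp only [mem_filter, mem_univ, true_and, Sum.elim_inl, Sum.elim_inr]
    grind

theorem exists_isSeparator_of_cut_lt {X : Finset (V ⊕ V)} (hu : .inr u ∈ X) (hv : .inl v ∉ X)
    (huv : u ≠ v) (hX : cut (splitNetwork G S) X < Fintype.card V) :
    ∃ U ⊆ S, #U ≤ cut (splitNetwork G S) X ∧ IsSeparator G S U u v := by
  classical
  refine ⟨{w ∈ S | .inl w ∈ X ∧ .inr w ∉ X}, filter_subset _ _, ?_, by simp [hu], by simp [hv],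
    insert u {w | .inl w ∈ X ∧ .inr w ∈ X}, ?_⟩
  · rw [cut_splitNetwork]
    exact Nat.le_add_right _ _
  refine ⟨Set.mem_insert _ _, by simp [hv, huv.symm], fun a ha b hb hbU hab => .inr ?_⟩
  have ha : .inr a ∈ X := by
    rcases ha with rfl | ha
    exacts [hu, ha.2]
  have hb' : .inl b ∈ X := by
    by_contra hbX
    rw [cut_splitNetwork] at hX
    have hpos : 0 < #{x : V × V | .inr x.1 ∈ X ∧ .inl x.2 ∉ X ∧ G.Adj x.1 x.2} :=
      card_pos.2 ⟨(a, b), by simp [*]⟩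
    nlinarith
  exact ⟨hb', by simpa [hb, hb'] using hbU⟩

theorem lt_iff_exists_isSeparator (hu : u ∈ S) (hv : v ∈ S) (huv : u ≠ v) (hadj : ¬ G.Adj u v)
    (hle : ∀ X, .inr u ∈ X → .inl v ∉ X → q ≤ cut (splitNetwork G S) X)
    (hmax : Fintype.card V ≤ q ∨ ∃ X, .inr u ∈ X ∧ .inl v ∉ X ∧ cut (splitNetwork G S) X = q) :
    q < t ↔ ∃ U ⊆ S, #U < t ∧ IsSeparator G S U u v := by
  have hle_card {U} (h : IsSeparator G S U u v) : q ≤ #U := by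
    obtain ⟨X, huX, hvX, hX⟩ := h.exists_cut_le hv
    exact (hle X huX hvX).trans hX
  refine ⟨fun hqt => ?_, fun ⟨U, _, hU, h⟩ => (hle_card h).trans_lt hU⟩
  have hrest : IsSeparator G S ((S.erase u).erase v) u v := by
    refine ⟨by simp, by simp, {u}, rfl, by simpa using huv.symm, ?_⟩
    rintro a rfl b hb hbU hab
    have : b ≠ v := fun hbv => hadj (hbv ▸ hab)
    simpa [this, hb] using hbU
  have hlt : q < Fintype.card V := calc
    q ≤ #((S.erase u).erase v) := hle_card hrest
    _ ≤ #(S.erase u) := card_erase_le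
    _ < #S := card_erase_lt_of_mem hu
    _ ≤ Fintype.card V := card_le_univ _
  obtain ⟨X, huX, hvX, rfl⟩ := hmax.resolve_left hlt.not_ge
  obtain ⟨U, hU, hcard, hsep⟩ := exists_isSeparator_of_cut_lt huX hvX huv hlt
  exact ⟨U, hU, hcard.trans_lt hqt, hsep⟩

end SplitNetwork

end TwoClub

namespace WordRAM

open Finset TwoClub

/-! ### The test for connected 2-clubs -/

@[simp] abbrev Reg.capacity : ℕ := 38

section Connected

variable {B N n t k : ℕ} {G : SimpleGraph (Fin n)} {S : Finset (Fin n)} {u v : Fin n} {s : Store}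

/-- The network `splitNetwork G S` on numbered nodes: the entry of a vertex `w` has number `w`, and
its exit has number `n + w`. -/
noncomputable def numberedNetwork (G : SimpleGraph (Fin n)) (S : Finset (Fin n)) :
    Fin (n + n) → Fin (n + n) → ℕ :=
  fun x y => splitNetwork G S (finSumFinEquiv.symm x) (finSumFinEquiv.symm y)

/-- Compute the entry of `numberedNetwork` for the arc from `Reg.tail` to `Reg.head`. -/
def computeCapacity : Prog :=
  .cond (Reg.tail <ₑ Reg.size)
    (.set Reg.capacity ((Reg.tail + Reg.size =ₑ Reg.head) * .cell Arr.set Reg.tail))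
    (.cond (Reg.head <ₑ Reg.size)
      (.set Reg.capacity (Reg.size * adj (Reg.tail - Reg.size) Reg.head)) (.set Reg.capacity 0))

theorem wp_computeCapacity (hE : Encodes B N G t k s) (hS : HoldsSet Arr.set S s)
    {x y : Fin (n + n)} (hx : s.reg Reg.tail = x) (hy : s.reg Reg.head = y) :
    WP B N computeCapacity (fun s' => s'.reg Reg.capacity = numberedNetwork G S x y) s := by
  classical
  obtain ⟨a, rfl⟩ := finSumFinEquiv.surjective x
  obtain ⟨b, rfl⟩ := finSumFinEquiv.surjective y
  simp only [numberedNetwork, Equiv.symm_apply_apply]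
  have hB := hE.word
  refine WP.cond ((Expr.HasValue.reg hx).lt (.reg hE.size)) (fun ha => ?_) fun ha =>
    WP.cond ((Expr.HasValue.reg hy).lt (.reg hE.size)) (fun hb => ?_) fun hb => ?_
  · rcases a with w | w
    · rw [finSumFinEquiv_apply_left, Fin.val_castAdd] at hx
      have hexit : (Reg.tail + Reg.size : Expr).HasValue B s (w + n) :=
        (Expr.HasValue.reg hx).add (.reg hE.size) (by nlinarith [w.isLt])
      have hcap := ((hexit.eq (.reg hy)).and (hS.decides (.reg hx))).hasValue
      refine (WP.assign hcap).mono fun s' _ hs' => hs'.trans ?_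
      rcases b with x | x
      · simp only [finSumFinEquiv_apply_left, Fin.val_castAdd, splitNetwork]
        grind
      · simp only [finSumFinEquiv_apply_right, Fin.val_natAdd, splitNetwork]
        grind
    · simp at ha
  · rcases a with w | w
    · simp at ha
    · rcases b with x | x
      · rw [finSumFinEquiv_apply_right, Fin.val_natAdd] at hx
        rw [finSumFinEquiv_apply_left, Fin.val_castAdd] at hy
        have hw : (Reg.tail - Reg.size : Expr).HasValue B s w := by
          simpa using (Expr.HasValue.reg hx).sub (.reg hE.size)
        have hcap := (Expr.HasValue.reg hE.size).mul (hE.decides_adj hw (.reg hy)).hasValue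
          (by split_ifs <;> nlinarith)
        exact (WP.assign hcap).mono fun s' _ hs' => by simpa [splitNetwork] using hs'
      · simp at hb
  · refine (WP.assign .zero).mono fun s' _ hs' => hs'.trans ?_
    rcases a with w | w <;> rcases b with x | x <;> simp_all [splitNetwork]

/-- Store the network in which a flow from the exit of `Reg.fst` to the entry of `Reg.snd` is
sought. -/
def buildNetwork : Prog :=
  .set Reg.nodes (Reg.size + Reg.size) ;; .set Reg.source (Reg.size + Reg.fst) ;;
  .set Reg.sink Reg.snd ;;
  .forPairs Reg.tail Reg.head Reg.nodes
    (computeCapacity ;; .store Arr.residual (arcIndex Reg.tail Reg.head) Reg.capacity)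

theorem wp_buildNetwork (hE : Encodes B N G t k s) (hS : HoldsSet Arr.set S s)
    (hu : s.reg Reg.fst = u) (hv : s.reg Reg.snd = v) :
    WP B N buildNetwork (HoldsNetwork B N (numberedNetwork G S) (finSumFinEquiv (.inr u))
      (finSumFinEquiv (.inl v))) s := by
  have hB := hE.word
  refine (WP.assign ((Expr.HasValue.reg hE.size).add (.reg hE.size) (by nlinarith))).bind
    fun s₁ hf₁ hnodes => ?_
  refine (WP.assign ((Expr.HasValue.reg (hE.frame hf₁).size).add
    (.reg ((hf₁.reg _ rfl).trans hu)) (by nlinarith [u.isLt]))).bind fun s₂ hf₂ hsource => ?_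
  refine (WP.assign (.reg ((hf₂.reg _ rfl).trans ((hf₁.reg _ rfl).trans hv)))).bind
    fun s₃ hf₃ hsink => ?_
  have hE₃ := ((hE.frame hf₁).frame hf₂).frame hf₃
  have hS₃ := ((hS.frame hf₁).frame hf₂).frame hf₃
  have hnodes₃ : s₃.reg Reg.nodes = n + n := (hf₃.reg _ rfl).trans ((hf₂.reg _ rfl).trans hnodes)
  have hloops : n + n ≤ N := by linarith [hE.loops]
  refine (WP.forPairs (fun D s' => ∀ x ∈ D, s'.arr Arr.residual (x.1 * (n + n) + x.2) =
    numberedNetwork G S x.1 x.2) hnodes₃ hloops (by simp) fun D x s' hf hx₁ hx₂ hD => ?_).mono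
      fun s' hf hres => ?_
  · refine (wp_computeCapacity (hE₃.frame hf) (hS₃.frame hf) hx₁ hx₂).bind fun s₄ hf₄ hcap => ?_
    refine (WP.write (.index (.reg ((hf₄.reg _ rfl).trans hx₁))
      ((hf₄.reg _ rfl).trans ((hf.reg _ rfl).trans hnodes₃)) (.reg ((hf₄.reg _ rfl).trans hx₂)) ?_)
      (.reg hcap)).mono fun s₅ _ h₅ y hy => ?_
    · nlinarith [x.1.isLt, x.2.isLt]
    · rw [h₅, hf₄.arr _ rfl]
      rcases eq_or_ne y x with rfl | hyx
      · exact Function.update_self ..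
      · rw [Function.update_of_ne fun h => hyx (Prod.ext (Fin.ext (index_inj h).1) (index_inj h).2)]
        exact hD y ((mem_insert.1 hy).resolve_left hyx)
  · refine ⟨by nlinarith, hloops, fun x y => ?_, (hf.reg _ rfl).trans hnodes₃, ?_, ?_,
      fun x y => hres (x, y) (mem_univ _)⟩
    · refine (splitNetwork_add_swap_le _ _).trans ?_
      rw [Fintype.card_fin]
      nlinarith
    · rw [hf.reg _ rfl, hf₃.reg _ rfl, hsource, finSumFinEquiv_apply_right, Fin.val_natAdd]
    · rw [hf.reg _ rfl, hsink, finSumFinEquiv_apply_left, Fin.val_castAdd]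

theorem flow_lt_iff {q : ℕ} (hu : u ∈ S) (hv : v ∈ S) (huv : u ≠ v) (hadj : ¬ G.Adj u v)
    (hle : ∀ X, finSumFinEquiv (.inr u) ∈ X → finSumFinEquiv (.inl v) ∉ X →
      q ≤ cut (numberedNetwork G S) X)
    (hmax : q = n + n ∨ ∃ X, finSumFinEquiv (.inr u) ∈ X ∧ finSumFinEquiv (.inl v) ∉ X ∧
      cut (numberedNetwork G S) X = q) :
    q < t ↔ ∃ U ⊆ S, #U < t ∧ IsSeparator G S U u v := by
  refine lt_iff_exists_isSeparator hu hv huv hadj (fun X hX hX' => ?_)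
    (hmax.imp (fun hq => by simp [hq]) ?_)
  · rw [← cut_map finSumFinEquiv]
    exact hle _ (mem_map_of_mem _ hX) (by simpa using hX')
  · rintro ⟨X, hX, hX', rfl⟩
    refine ⟨X.map finSumFinEquiv.symm.toEmbedding, mem_map_equiv.2 hX,
      fun h => hX' (mem_map_equiv.1 h), ?_⟩
    rw [← cut_map finSumFinEquiv]
    congr 1
    ext
    simp

/-- Test whether `Reg.fst` and `Reg.snd` form an obstruction to connected 2-clubs. -/
def connectedTest : Prog :=
  .cond (adj Reg.fst Reg.snd) (.set Reg.answer 0)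
    (countCommon ;;
      .cond (0 <ₑ Reg.common) (buildNetwork ;; maxFlow ;; .set Reg.answer (Reg.flow <ₑ Reg.param))
        (.set Reg.answer 1))

theorem isTest_connectedTest :
    IsTest (fun _ G t => IsConnectedObstruction t G) connectedTest where
  reg := by decide
  arr := by decide
  decides {B} _ _ _ _ _ _ _ _ _ hE hS hu hv huS hvS huv := by
    refine WP.cond (hE.decides_adj (.reg hu) (.reg hv)) (fun hadj => ?_) fun hadj => ?_
    · exact (WP.assign .zero).mono fun _ _ h => Expr.HasValue.reg (h.trans (if_neg (·.1 hadj)).symm)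
    refine (wp_countCommon hE hS hu hv).bind fun s₁ hf₁ hcommon => ?_
    refine WP.cond (Expr.HasValue.zero.lt (.reg hcommon)) (fun hpos => ?_) fun hpos => ?_
    · refine (wp_buildNetwork (hE.frame hf₁) (hS.frame hf₁) ((hf₁.reg _ rfl).trans hu)
        ((hf₁.reg _ rfl).trans hv)).bind fun s₂ hf₂ hN => ?_
      refine (wp_maxFlow hN).bind fun s₃ hf₃ hflow => ?_
      refine (WP.assign ((Expr.HasValue.reg (rfl : s₃.reg Reg.flow = _)).lt
        (.reg (((hE.frame hf₁).frame hf₂).frame hf₃).param))).mono fun s₄ _ h₄ => ?_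
      refine Expr.Decides.congr (.reg h₄) ((flow_lt_iff huS hvS huv hadj hflow.1 hflow.2).trans ?_)
      rw [IsConnectedObstruction, ← card_eq_zero]
      simp only [hadj, hpos.ne', not_false_iff, true_and, false_or]
    · refine (WP.assign .one).mono fun _ _ h => Expr.HasValue.reg (h.trans (if_pos ?_).symm)
      exact ⟨hadj, .inl (by simpa using hpos)⟩

theorem isSizeTest_lt_and_not_lt :
    IsSizeTest (fun t k m => t < m ∧ k ≤ m)
      ((Reg.param <ₑ Reg.count) * ((Reg.count <ₑ Reg.target) =ₑ 0)) :=
  fun hparam htarget hcount => ((Expr.HasValue.reg hparam).lt (.reg hcount)).and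
    (((Expr.HasValue.reg hcount).lt (.reg htarget)).not.congr not_lt)

theorem solvableInTimeO_connectedTwoClub : SolvableInTimeO ConnectedTwoClub fun n => 1.62 ^ n :=
  solvableInTimeO_of_isTest isTest_connectedTest isSizeTest_lt_and_not_lt
    (fun _ _ _ _ _ => isConnectedObstruction_antitone)
    (fun _ _ _ _ h => And.imp h.trans_lt' h.trans')
    fun _ _ _ _ => exists_congr fun _ => (and_congr_left' isConnected_iff).trans and_assoc

end Connected

end WordRAM

theorem mainTheorem6 :
    WordRAM.SolvableInTimeO TwoClub.RobustTwoClub (fun n => (1.62 : ℝ) ^ n) ∧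
      WordRAM.SolvableInTimeO TwoClub.HereditaryTwoClub (fun n => (1.62 : ℝ) ^ n) ∧
      WordRAM.SolvableInTimeO TwoClub.ConnectedTwoClub (fun n => (1.62 : ℝ) ^ n) :=
  ⟨WordRAM.solvableInTimeO_robustTwoClub, WordRAM.solvableInTimeO_hereditaryTwoClub,
    WordRAM.solvableInTimeO_connectedTwoClub⟩
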